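/- Let $K$ be a field and $Q=(Q_0,Q_1,s,r)$ an arbitrary quiver. The Kronecker square $\widehat Q$ has vertices $[u,v]$ ($u,v\in Q_0$) and arrows $[e,f]$ ($e,f\in Q_1$) with source $[s(e),s(f)]$ and range $[r(e),r(f)]$. For a quiver $E$ let $L_K(E)$ be its Leavitt path algebra: the associative, not necessarily unital, $K$-algebra generated by the vertices $v$, the arrows $e$ and the ghost arrows $e^*$, subject to $vw=\delta_{v,w}v$; $s(e)e=e=e\,r(e)$; $r(e)e^*=e^*=e^*s(e)$; $e^*f=\delta_{e,f}r(e)$; and $v=\sum_{s(e)=v}ee^*$ for every vertex $v$ that emits at least one and only finitely many arrows. It is $\mathbb Z$-graded, with $L_K(E)_n$ spanned by the elements $\alpha\beta^*$ where $\alpha,\beta$ are paths, $r(\alpha)=r(\beta)$ and $|\alpha|-|\beta|=n$. For a vertex $u$ let $T(u)$ be the set of all vertices reachable from $u$ by a (possibly trivial) path. A vertex $u$ is a sink if it emits no arrow. It is a ray point if $T(u)$ is a straight line segment, finite or infinite, that is, no vertex of $T(u)$ emits two or more arrows or lies on a cycle. It is a Laurent vertex if $T(u)$ is a finite straight line segment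 ending at a cycle without exits, that is, $T(u)$ is finite, no vertex of $T(u)$ emits two or more arrows, and some vertex of $T(u)$ is the base of a cycle without exits. Let $S\subseteq L_K(\widehat Q)$ be the diagonal copy of $L_K(Q)$: the (not necessarily unital) $K$-subalgebra generated by all $[v,v]$, $[e,e]$ and $[e,e]^*$ with $v\in Q_0$, $e\in Q_1$. Suppose that $S$ is a two-sided ideal of $L_K(\widehat Q)$. Then: (a) every vertex of $Q$ is a sink, a ray point or a Laurent vertex; (b) $L_K(\widehat Q)$ is a graded semisimple ring: as a left module over itself it is a direct sum of graded simple left ideals, and as a right module over itself it is a direct sum of graded simple right ideals; (c) the assignment $v\mapsto[v,v]$, $e\mapsto[e,e]$, $e^*\mapsto[e,e]^*$ extends to an injective $K$-algebra homomorphism $\varphi:L_K(Q)\to L_K(\widehat Q)$ with image $S$ and with $\varphi(x)\in L_K(\widehat Q)_n$ if and only if $x\in L_K(Q)_n$; the ideal $S$ is homogeneous; and the resulting graded exact sequence $$0\to L_K(Q)\xrightarrow{\ \varphi\ } L_K(\widehat Q)\to L_K(\widehat Q)/S\to 0$$ splits both as a sequence of graded left $L_K(\widehat Q)$-modules and as a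 sequence of graded right $L_K(\widehat Q)$-modules, by degree-preserving module homomorphisms. -/

import Mathlib

universe v u

namespace Leavitt

/-! ### Quivers -/

section QuiverNotions

variable {V : Type u} [Quiver.{v} V]

/-- The arrows emitted by the vertex `a`. -/
def emitted (a : V) : Set (Quiver.Total V) := {e | e.left = a}

/-- A sink emits no arrow. -/
def IsSink (a : V) : Prop := emitted a = ∅

/-- A regular vertex emits at least one and only finitely many arrows. -/
def IsRegular (a : V) : Prop := (emitted a).Nonempty ∧ (emitted a).Finite

/-- There is a bifurcation at `a` if `a` emits at least two arrows. -/
def IsBifurcation (a : V) : Prop := (emitted a).Nontrivial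

/-- The tree `T(a)`: all vertices that can be reached from `a` by a path
(the trivial path included). -/
def tree (a : V) : Set V := {w | Nonempty (Quiver.Path a w)}

/-- The list of arrows `e₁, …, eₙ` of a path `e₁ ⋯ eₙ`. -/
def arrows {a : V} : {b : V} → Quiver.Path a b → List (Quiver.Total V)
  | _, .nil => []
  | _, .cons p e => arrows p ++ [⟨_, _, e⟩]

/-- A cycle is a closed path `e₁ ⋯ eₙ` with `n ≥ 1` and `s(eᵢ) ≠ s(eⱼ)` for `i ≠ j`. -/
def IsCycle {a : V} (c : Quiver.Path a a) : Prop :=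
  0 < c.length ∧ ((arrows c).map Quiver.Total.left).Nodup

/-- A path has an exit if some arrow `f` satisfies `s(f) = s(eᵢ)` and `f ≠ eᵢ` for
one of the arrows `eᵢ` of the path. -/
def HasExit {a b : V} (p : Quiver.Path a b) : Prop :=
  ∃ e ∈ arrows p, ∃ f : Quiver.Total V, f.left = e.left ∧ f ≠ e

/-- `a` is a ray point if its tree is a straight line segment, finite or infinite: the tree
contains neither bifurcations nor cycles. -/
def IsRayPoint (a : V) : Prop :=
  ∀ w ∈ tree a, ¬ IsBifurcation w ∧ ∀ c : Quiver.Path w w, ¬ IsCycle c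

/-- `a` is a Laurent vertex if its tree is a finite straight line segment, without bifurcations,
ending at a cycle without exits. -/
def IsLaurentVertex (a : V) : Prop :=
  (tree a).Finite ∧ (∀ w ∈ tree a, ¬ IsBifurcation w) ∧
    ∃ w ∈ tree a, ∃ c : Quiver.Path w w, IsCycle c ∧ ¬ HasExit c

end QuiverNotions

/-- The vertices of the Kronecker square of a quiver: pairs `[a, b]` of vertices. -/
@[ext]
structure KroneckerSquare (V : Type u) : Type u where
  fst : V
  snd : V

/-- The arrows of the Kronecker square: pairs `[e, f]` of arrows, from `[s(e), s(f)]` to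
`[r(e), r(f)]`. -/
instance (V : Type u) [Quiver.{v} V] : Quiver.{v} (KroneckerSquare V) where
  Hom x y := (x.fst ⟶ y.fst) × (x.snd ⟶ y.snd)

/-- The arrow `[e, f]` of the Kronecker square. -/
def pairArrow {V : Type u} [Quiver.{v} V] (e f : Quiver.Total V) :
    Quiver.Total (KroneckerSquare V) where
  left := ⟨e.left, f.left⟩
  right := ⟨e.right, f.right⟩
  hom := (e.hom, f.hom)

/-! ### The Leavitt path algebra -/

/-- The generators of the Leavitt path algebra: vertices `a`, arrows `e`, ghost arrows `e*`. -/
inductive Generator (V : Type u) [Quiver.{v} V] : Type (max u v)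
  | vertex (a : V)
  | arrow (e : Quiver.Total V)
  | ghost (e : Quiver.Total V)

/-- The free associative (not necessarily unital) `K`-algebra on the generators. -/
abbrev FreeAlg (K : Type*) [Field K] (V : Type u) [Quiver.{v} V] :=
  MonoidAlgebra K (FreeSemigroup (Generator V))

section Presentation

variable (K : Type*) [Field K] (V : Type u) [Quiver.{v} V]

/-- A generator as an element of the free algebra. -/
noncomputable def FreeAlg.of (x : Generator V) : FreeAlg K V :=
  MonoidAlgebra.single (FreeSemigroup.of x) 1

open Generator in
/-- The defining relations of the Leavitt path algebra. The last constructor makes sure that the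
ideal they generate is closed under scalars: the free algebra has no unit. -/
inductive Relation : FreeAlg K V → FreeAlg K V → Prop
  | vertex_mul_self (a : V) :
      Relation (FreeAlg.of K V (vertex a) * FreeAlg.of K V (vertex a)) (FreeAlg.of K V (vertex a))
  | vertex_mul_vertex (a b : V) (h : a ≠ b) :
      Relation (FreeAlg.of K V (vertex a) * FreeAlg.of K V (vertex b)) 0
  | left_mul_arrow (e : Quiver.Total V) :
      Relation (FreeAlg.of K V (vertex e.left) * FreeAlg.of K V (arrow e))
        (FreeAlg.of K V (arrow e))
  | arrow_mul_right (e : Quiver.Total V) :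
      Relation (FreeAlg.of K V (arrow e) * FreeAlg.of K V (vertex e.right))
        (FreeAlg.of K V (arrow e))
  | right_mul_ghost (e : Quiver.Total V) :
      Relation (FreeAlg.of K V (vertex e.right) * FreeAlg.of K V (ghost e))
        (FreeAlg.of K V (ghost e))
  | ghost_mul_left (e : Quiver.Total V) :
      Relation (FreeAlg.of K V (ghost e) * FreeAlg.of K V (vertex e.left))
        (FreeAlg.of K V (ghost e))
  | ghost_mul_arrow_self (e : Quiver.Total V) :
      Relation (FreeAlg.of K V (ghost e) * FreeAlg.of K V (arrow e))
        (FreeAlg.of K V (vertex e.right))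
  | ghost_mul_arrow (e f : Quiver.Total V) (h : e ≠ f) :
      Relation (FreeAlg.of K V (ghost e) * FreeAlg.of K V (arrow f)) 0
  | cuntz_krieger (a : V) (h : IsRegular a) :
      Relation (FreeAlg.of K V (vertex a))
        (∑ e ∈ h.2.toFinset, FreeAlg.of K V (arrow e) * FreeAlg.of K V (ghost e))
  | smul (k : K) {x y : FreeAlg K V} (h : Relation x y) : Relation (k • x) (k • y)

/-- The ring congruence generated by the defining relations. -/
noncomputable def leavittCon : RingCon (FreeAlg K V) := ringConGen (Relation K V)

theorem leavittCon_smul (k : K) {x y : FreeAlg K V} (h : leavittCon K V x y) :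
    leavittCon K V (k • x) (k • y) := by
  change RingConGen.Rel (Relation K V) x y at h
  change RingConGen.Rel (Relation K V) (k • x) (k • y)
  induction h with
  | of x y h => exact .of _ _ (.smul k h)
  | refl x => exact .refl _
  | symm _ ih => exact .symm ih
  | trans _ _ ih₁ ih₂ => exact .trans ih₁ ih₂
  | add _ _ ih₁ ih₂ => rw [smul_add, smul_add]; exact .add ih₁ ih₂
  | mul _ h₂ ih₁ _ =>
    rw [← smul_mul_assoc, ← smul_mul_assoc]
    exact .mul ih₁ h₂

/-- The Leavitt path algebra `L_K(Q)` of a quiver `Q` with vertex set `V`, as an associative, not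
necessarily unital, `K`-algebra given by generators and relations. -/
def LeavittPathAlgebra : Type _ := (leavittCon K V).Quotient

noncomputable instance : NonUnitalRing (LeavittPathAlgebra K V) :=
  inferInstanceAs (NonUnitalRing (leavittCon K V).Quotient)

/-- The quotient map from the free algebra. -/
noncomputable def LeavittPathAlgebra.mk : FreeAlg K V →ₙ+* LeavittPathAlgebra K V where
  toFun x := ((x : (leavittCon K V).Quotient) : LeavittPathAlgebra K V)
  map_mul' _ _ := rfl
  map_zero' := rfl
  map_add' _ _ := rfl

theorem LeavittPathAlgebra.mk_surjective :
    Function.Surjective (LeavittPathAlgebra.mk K V) :=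
  fun x => Quotient.exists_rep x

noncomputable instance : SMul K (LeavittPathAlgebra K V) where
  smul k := Quotient.map' (fun x => k • x) (fun _ _ h => leavittCon_smul K V k h)

theorem LeavittPathAlgebra.mk_smul (k : K) (x : FreeAlg K V) :
    LeavittPathAlgebra.mk K V (k • x) = k • LeavittPathAlgebra.mk K V x := rfl

noncomputable instance : Module K (LeavittPathAlgebra K V) :=
  Function.Surjective.module K (LeavittPathAlgebra.mk K V).toAddMonoidHom
    (LeavittPathAlgebra.mk_surjective K V) (LeavittPathAlgebra.mk_smul K V)

instance : IsScalarTower K (LeavittPathAlgebra K V) (LeavittPathAlgebra K V) where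
  smul_assoc k x y := by
    obtain ⟨x, rfl⟩ := LeavittPathAlgebra.mk_surjective K V x
    obtain ⟨y, rfl⟩ := LeavittPathAlgebra.mk_surjective K V y
    simp only [smul_eq_mul, ← LeavittPathAlgebra.mk_smul, ← map_mul, smul_mul_assoc]

instance : SMulCommClass K (LeavittPathAlgebra K V) (LeavittPathAlgebra K V) where
  smul_comm k x y := by
    obtain ⟨x, rfl⟩ := LeavittPathAlgebra.mk_surjective K V x
    obtain ⟨y, rfl⟩ := LeavittPathAlgebra.mk_surjective K V y
    simp only [smul_eq_mul, ← LeavittPathAlgebra.mk_smul, ← map_mul, mul_smul_comm]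

end Presentation

section Elements

variable (K : Type*) [Field K] {V : Type u} [Quiver.{v} V]

/-- The element `a` of `L_K(Q)`, for a vertex `a`. -/
noncomputable def vertex (a : V) : LeavittPathAlgebra K V :=
  LeavittPathAlgebra.mk K V (FreeAlg.of K V (.vertex a))

/-- The element `e` of `L_K(Q)`, for an arrow `e`. -/
noncomputable def arrow (e : Quiver.Total V) : LeavittPathAlgebra K V :=
  LeavittPathAlgebra.mk K V (FreeAlg.of K V (.arrow e))

/-- The element `e*` of `L_K(Q)`, for an arrow `e`. -/
noncomputable def ghost (e : Quiver.Total V) : LeavittPathAlgebra K V :=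
  LeavittPathAlgebra.mk K V (FreeAlg.of K V (.ghost e))

/-- The element `e₁ ⋯ eₙ` of `L_K(Q)`, for a path `e₁ ⋯ eₙ`; a vertex, for a trivial path. -/
noncomputable def pathElt {a : V} : {b : V} → Quiver.Path a b → LeavittPathAlgebra K V
  | _, .nil => vertex K a
  | _, .cons p e => pathElt p * arrow K ⟨_, _, e⟩

/-- The element `eₙ* ⋯ e₁*` of `L_K(Q)`, for a path `e₁ ⋯ eₙ`; a vertex, for a trivial path. -/
noncomputable def ghostPathElt {a : V} : {b : V} → Quiver.Path a b → LeavittPathAlgebra K V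
  | _, .nil => vertex K a
  | _, .cons p e => ghost K ⟨_, _, e⟩ * ghostPathElt p

variable (V) in
/-- The homogeneous component of degree `n` of `L_K(Q)`: the span of all `α β*` with
`r(α) = r(β)` and `|α| - |β| = n`. -/
noncomputable def component (n : ℤ) : Submodule K (LeavittPathAlgebra K V) :=
  Submodule.span K {x | ∃ (a b c : V) (α : Quiver.Path a c) (β : Quiver.Path b c),
    (α.length : ℤ) - (β.length : ℤ) = n ∧ x = pathElt K α * ghostPathElt K β}

variable (V) in
/-- The diagonal copy of `L_K(Q)` in the Leavitt path algebra of the Kronecker square: the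
subalgebra generated by all `[a, a]`, `[e, e]` and `[e, e]*`. -/
noncomputable def diagonalSubalgebra :
    NonUnitalSubalgebra K (LeavittPathAlgebra K (KroneckerSquare V)) :=
  NonUnitalAlgebra.adjoin K
    (Set.range (fun a : V => vertex K (⟨a, a⟩ : KroneckerSquare V)) ∪
      Set.range (fun e : Quiver.Total V => arrow K (pairArrow e e)) ∪
      Set.range (fun e : Quiver.Total V => ghost K (pairArrow e e)))

/-- A homomorphism `L_K(Q) → L_K(Q̂)` is diagonal if `a ↦ [a, a]`, `e ↦ [e, e]` and
`e* ↦ [e, e]*`. -/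
def IsDiagonal
    (φ : LeavittPathAlgebra K V →ₙₐ[K] LeavittPathAlgebra K (KroneckerSquare V)) : Prop :=
  (∀ a : V, φ (vertex K a) = vertex K (⟨a, a⟩ : KroneckerSquare V)) ∧
  (∀ e : Quiver.Total V, φ (arrow K e) = arrow K (pairArrow e e)) ∧
  (∀ e : Quiver.Total V, φ (ghost K e) = ghost K (pairArrow e e))

end Elements

/-! ### Graded ideals, graded semisimplicity, graded splitting

`A` is an associative, not necessarily unital, `K`-algebra with a family `𝒜` of homogeneous
components. A left ideal of a ring with local units is automatically a `K`-subspace, so left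
ideals are taken as `K`-subspaces; the same for right ideals. -/

section Graded

variable {K A : Type*} [Field K] [NonUnitalRing A] [Module K A]

def IsLeftIdeal (I : Submodule K A) : Prop := ∀ a : A, ∀ x ∈ I, a * x ∈ I

def IsRightIdeal (I : Submodule K A) : Prop := ∀ a : A, ∀ x ∈ I, x * a ∈ I

/-- `I` is spanned by its homogeneous elements. -/
def IsHomogeneous (𝒜 : ℤ → Submodule K A) (I : Submodule K A) : Prop :=
  I ≤ ⨆ n, I ⊓ 𝒜 n

/-- The left ideal `I` is homogeneous and is a graded simple left module: `A I ≠ 0`, and the only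
homogeneous left ideals inside `I` are `0` and `I`. -/
structure IsGradedSimpleLeft (𝒜 : ℤ → Submodule K A) (I : Submodule K A) : Prop where
  isLeftIdeal : IsLeftIdeal I
  isHomogeneous : IsHomogeneous 𝒜 I
  mul_ne_zero : ∃ a : A, ∃ x ∈ I, a * x ≠ 0
  eq_bot_or_eq : ∀ J ≤ I, IsLeftIdeal J → IsHomogeneous 𝒜 J → J = ⊥ ∨ J = I

/-- The right ideal `I` is homogeneous and is a graded simple right module. -/
structure IsGradedSimpleRight (𝒜 : ℤ → Submodule K A) (I : Submodule K A) : Prop where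
  isRightIdeal : IsRightIdeal I
  isHomogeneous : IsHomogeneous 𝒜 I
  mul_ne_zero : ∃ a : A, ∃ x ∈ I, x * a ≠ 0
  eq_bot_or_eq : ∀ J ≤ I, IsRightIdeal J → IsHomogeneous 𝒜 J → J = ⊥ ∨ J = I

/-- `A` is graded semisimple: as a left module over itself it is the direct sum of graded simple
left ideals, and likewise on the right. -/
def IsGradedSemisimple (𝒜 : ℤ → Submodule K A) : Prop :=
  (∃ 𝓢 : Set (Submodule K A),
    (∀ I ∈ 𝓢, IsGradedSimpleLeft 𝒜 I) ∧ sSupIndep 𝓢 ∧ sSup 𝓢 = ⊤) ∧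
  (∃ 𝓢 : Set (Submodule K A),
    (∀ I ∈ 𝓢, IsGradedSimpleRight 𝒜 I) ∧ sSupIndep 𝓢 ∧ sSup 𝓢 = ⊤)

/-- For a left ideal `I`, the projection `A → A / I` has a section that is a degree-preserving
homomorphism of left `A`-modules, where `a · (x + I) = a x + I` and `A / I` carries the quotient
grading. -/
def SplitsLeft (𝒜 : ℤ → Submodule K A) (I : Submodule K A) : Prop :=
  ∃ σ : (A ⧸ I) →ₗ[K] A, (∀ y, I.mkQ (σ y) = y) ∧
    (∀ a x : A, σ (I.mkQ (a * x)) = a * σ (I.mkQ x)) ∧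
    ∀ n : ℤ, ∀ x ∈ 𝒜 n, σ (I.mkQ x) ∈ 𝒜 n

/-- For a right ideal `I`, the projection `A → A / I` has a section that is a degree-preserving
homomorphism of right `A`-modules. -/
def SplitsRight (𝒜 : ℤ → Submodule K A) (I : Submodule K A) : Prop :=
  ∃ σ : (A ⧸ I) →ₗ[K] A, (∀ y, I.mkQ (σ y) = y) ∧
    (∀ a x : A, σ (I.mkQ (x * a)) = σ (I.mkQ x) * a) ∧
    ∀ n : ℤ, ∀ x ∈ 𝒜 n, σ (I.mkQ x) ∈ 𝒜 n

end Graded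

end Leavitt

/-!
Let `S` be the diagonal subalgebra. Grading `L_K(Q̂)` by the number of occurrences of one chosen
arrow `[e, f]` with `e ≠ f` gives a derivation that kills `S` and fixes `[e, f]`. The action of
`L_K(Q̂)` on the functions on a branching system shows that `[e, f] ≠ 0`, hence `[e, f] ∉ S`. If
`s(e) = s(f)`, then `[e, f] = [s(e), s(f)] [e, f]` is a multiple of an element of `S`, so `S` is not
a right ideal; likewise `r(e) = r(f)` is impossible if `S` is a left ideal. The canonical involution
preserves `S`, so each of these two conditions on `S` implies the other.

Thus no vertex of `Q` emits two arrows, which gives (a), and the same is true in `Q̂`. Then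
`e e* = s(e)` for every arrow, and `α β*` depends only on the sources of `α` and `β` and on its
degree. Therefore every nonzero homogeneous element `x = x a`, with `a` a vertex, has a left
multiple equal to `a`, and `L_K(Q̂)` is the direct sum of the graded simple left ideals `L_K(Q̂) a`.

Finally, an arrow `[e, f]` with `e ≠ f` joins off-diagonal vertices, so killing the off-diagonal
generators defines a graded homomorphism from `L_K(Q̂)` to `L_K(Q)` that splits `φ`. A homomorphism
`π` of `A` onto an ideal `S` that is the identity on `S` is `A`-linear, for
`π(a x) = π(a) π(x) = π(a π(x)) = a π(x)`, and `x + S ↦ x - π(x)` splits `A → A / S`.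
-/

namespace Leavitt

section Generators

variable {K : Type*} [Field K] {V : Type u} [Quiver.{v} V]

theorem mk_eq_mk_of_relation {x y : FreeAlg K V} (h : Relation K V x y) :
    LeavittPathAlgebra.mk K V x = LeavittPathAlgebra.mk K V y :=
  Quotient.sound (RingCon.le_ringConGen (r := Relation K V) _ _ h)

theorem vertex_mul_self (a : V) : vertex K a * vertex K a = vertex K a :=
  mk_eq_mk_of_relation (.vertex_mul_self a)

theorem vertex_mul_vertex_of_ne {a b : V} (h : a ≠ b) : vertex K a * vertex K b = 0 :=
  mk_eq_mk_of_relation (.vertex_mul_vertex a b h)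

theorem left_mul_arrow (e : Quiver.Total V) : vertex K e.left * arrow K e = arrow K e :=
  mk_eq_mk_of_relation (.left_mul_arrow e)

theorem arrow_mul_right (e : Quiver.Total V) : arrow K e * vertex K e.right = arrow K e :=
  mk_eq_mk_of_relation (.arrow_mul_right e)

theorem right_mul_ghost (e : Quiver.Total V) : vertex K e.right * ghost K e = ghost K e :=
  mk_eq_mk_of_relation (.right_mul_ghost e)

theorem ghost_mul_left (e : Quiver.Total V) : ghost K e * vertex K e.left = ghost K e :=
  mk_eq_mk_of_relation (.ghost_mul_left e)

theorem ghost_mul_arrow_self (e : Quiver.Total V) : ghost K e * arrow K e = vertex K e.right :=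
  mk_eq_mk_of_relation (.ghost_mul_arrow_self e)

theorem ghost_mul_arrow_of_ne {e f : Quiver.Total V} (h : e ≠ f) : ghost K e * arrow K f = 0 :=
  mk_eq_mk_of_relation (.ghost_mul_arrow e f h)

theorem vertex_eq_sum {a : V} (h : IsRegular a) :
    vertex K a = ∑ e ∈ h.2.toFinset, arrow K e * ghost K e := by
  have h_mk := mk_eq_mk_of_relation (K := K) (.cuntz_krieger a h)
  rw [map_sum] at h_mk
  exact h_mk.trans (Finset.sum_congr rfl fun e _ => map_mul _ _ _)

variable (K V) in
/-- The vertices, arrows and ghost arrows as elements of the Leavitt path algebra. -/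
def generators : Set (LeavittPathAlgebra K V) :=
  Set.range (vertex K) ∪ Set.range (arrow K) ∪ Set.range (ghost K)

theorem mk_of_mem_generators (g : Generator V) :
    LeavittPathAlgebra.mk K V (FreeAlg.of K V g) ∈ generators K V := by
  rcases g with a | e | e
  exacts [.inl (.inl ⟨a, rfl⟩), .inl (.inr ⟨e, rfl⟩), .inr ⟨e, rfl⟩]

theorem mk_single_mem_adjoin_generators (w : FreeSemigroup (Generator V)) (k : K) :
    LeavittPathAlgebra.mk K V (MonoidAlgebra.single w k) ∈
      NonUnitalAlgebra.adjoin K (generators K V) := by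
  induction w using FreeSemigroup.recOnMul generalizing k with
  | ih1 g =>
    rw [← mul_one k, ← smul_eq_mul, ← MonoidAlgebra.smul_single, LeavittPathAlgebra.mk_smul]
    exact SMulMemClass.smul_mem k
      (NonUnitalAlgebra.subset_adjoin K (mk_of_mem_generators g))
  | ih2 g w hg hw =>
    rw [← mul_one k, ← MonoidAlgebra.single_mul_single, map_mul]
    exact mul_mem (hg k) (hw 1)

theorem adjoin_generators : NonUnitalAlgebra.adjoin K (generators K V) = ⊤ := by
  refine NonUnitalAlgebra.eq_top_iff.2 fun x => ?_
  obtain ⟨x, rfl⟩ := LeavittPathAlgebra.mk_surjective K V x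
  induction x using MonoidAlgebra.induction_linear with
  | zero => exact zero_mem _
  | add x y hx hy => exact map_add (LeavittPathAlgebra.mk K V) x y ▸ add_mem hx hy
  | single w k => exact mk_single_mem_adjoin_generators w k

theorem algHom_ext {B : Type*} [NonUnitalSemiring B] [Module K B]
    {f g : LeavittPathAlgebra K V →ₙₐ[K] B}
    (hvertex : ∀ a, f (vertex K a) = g (vertex K a))
    (harrow : ∀ e, f (arrow K e) = g (arrow K e))
    (hghost : ∀ e, f (ghost K e) = g (ghost K e)) : f = g := by
  have h_le : (⊤ : NonUnitalSubalgebra K _) ≤ NonUnitalAlgHom.equalizer f g := by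
    rw [← adjoin_generators, NonUnitalAlgebra.adjoin_le_iff]
    rintro _ ((⟨a, rfl⟩ | ⟨e, rfl⟩) | ⟨e, rfl⟩)
    exacts [hvertex a, harrow e, hghost e]
  exact NonUnitalAlgHom.ext fun x => h_le (NonUnitalAlgebra.mem_top (x := x))

end Generators

section Lift

variable {K : Type*} [Field K] {V : Type u} [Quiver.{v} V] {B : Type*} [NonUnitalSemiring B]

/-- A Leavitt family in `B`: elements indexed by the vertices, arrows and ghost arrows of a quiver
that satisfy the defining relations of its Leavitt path algebra. -/
structure IsLeavittFamily (p : V → B) (s t : Quiver.Total V → B) : Prop where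
  vertex_mul_self : ∀ a, p a * p a = p a
  vertex_mul_vertex : ∀ a b, a ≠ b → p a * p b = 0
  left_mul_arrow : ∀ e, p e.left * s e = s e
  arrow_mul_right : ∀ e, s e * p e.right = s e
  right_mul_ghost : ∀ e, p e.right * t e = t e
  ghost_mul_left : ∀ e, t e * p e.left = t e
  ghost_mul_arrow_self : ∀ e, t e * s e = p e.right
  ghost_mul_arrow : ∀ e f, e ≠ f → t e * s f = 0
  vertex_eq_sum : ∀ (a : V) (h : IsRegular a), p a = ∑ e ∈ h.2.toFinset, s e * t e

variable [Module K B] [IsScalarTower K B B] [SMulCommClass K B B]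
variable {p : V → B} {s t : Quiver.Total V → B}

variable (K p s t) in
/-- The homomorphism from the free algebra with prescribed values on the vertices, the arrows and
the ghost arrows. -/
noncomputable def freeLift : FreeAlg K V →ₙₐ[K] B :=
  MonoidAlgebra.liftMagma K (FreeSemigroup.lift fun g : Generator V => g.rec p s t)

@[simp] theorem freeLift_of (g : Generator V) :
    freeLift K p s t (FreeAlg.of K V g) = g.rec p s t := by
  simp [freeLift, FreeAlg.of]

namespace IsLeavittFamily

variable (h : IsLeavittFamily p s t)
include h

theorem freeLift_eq_of_relation {x y : FreeAlg K V} (hxy : Relation K V x y) :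
    freeLift K p s t x = freeLift K p s t y := by
  induction hxy with
  | smul k _ ih => rw [map_smul, map_smul, ih]
  | vertex_mul_self a => simpa using h.vertex_mul_self a
  | vertex_mul_vertex a b hab => simpa using h.vertex_mul_vertex a b hab
  | left_mul_arrow e => simpa using h.left_mul_arrow e
  | arrow_mul_right e => simpa using h.arrow_mul_right e
  | right_mul_ghost e => simpa using h.right_mul_ghost e
  | ghost_mul_left e => simpa using h.ghost_mul_left e
  | ghost_mul_arrow_self e => simpa using h.ghost_mul_arrow_self e
  | ghost_mul_arrow e f hef => simpa using h.ghost_mul_arrow e f hef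
  | cuntz_krieger a ha => simpa [map_sum] using h.vertex_eq_sum a ha

theorem freeLift_eq_of_leavittCon {x y : FreeAlg K V} (hxy : leavittCon K V x y) :
    freeLift K p s t x = freeLift K p s t y := by
  change RingConGen.Rel (Relation K V) x y at hxy
  induction hxy with
  | of x y hxy => exact h.freeLift_eq_of_relation hxy
  | refl x => rfl
  | symm _ ih => exact ih.symm
  | trans _ _ ih₁ ih₂ => exact ih₁.trans ih₂
  | add _ _ ih₁ ih₂ => rw [map_add, map_add, ih₁, ih₂]
  | mul _ _ ih₁ ih₂ => rw [map_mul, map_mul, ih₁, ih₂]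

variable (K) in
/-- The universal property of the Leavitt path algebra: a Leavitt family in a `K`-algebra is the
image of the generators under a homomorphism. -/
noncomputable def lift : LeavittPathAlgebra K V →ₙₐ[K] B where
  toFun := Quotient.lift (freeLift K p s t) fun _ _ hxy => h.freeLift_eq_of_leavittCon hxy
  map_smul' k := (LeavittPathAlgebra.mk_surjective K V).forall.2 (map_smul (freeLift K p s t) k)
  map_zero' := map_zero (freeLift K p s t)
  map_add' := (LeavittPathAlgebra.mk_surjective K V).forall₂.2 (map_add (freeLift K p s t))
  map_mul' := (LeavittPathAlgebra.mk_surjective K V).forall₂.2 (map_mul (freeLift K p s t))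

@[simp] theorem lift_vertex (a : V) : h.lift K (vertex K a) = p a := freeLift_of (.vertex a)

@[simp] theorem lift_arrow (e : Quiver.Total V) : h.lift K (arrow K e) = s e :=
  freeLift_of (.arrow e)

@[simp] theorem lift_ghost (e : Quiver.Total V) : h.lift K (ghost K e) = t e :=
  freeLift_of (.ghost e)

end IsLeavittFamily

end Lift

section Branching

/-- A branching system: a set `X` over the vertices in which every point over `r(e)` can be extended
by the arrow `e` to a point over `s(e)`, such that a point arises in at most one way by extension,
and in exactly one way if it lies over a regular vertex. If `x` is the extension of `y` by `e`, then
`first x = some e` and `shift x = y`; the values of `step e` at other points than those over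
`r(e)`, and of `shift` at points with `first x = none`, are irrelevant. -/
structure BranchingSystem (V : Type u) [Quiver.{v} V] (X : Type*) where
  proj : X → V
  first : X → Option (Quiver.Total V)
  shift : X → X
  step : Quiver.Total V → X → X
  proj_of_first_eq_some : ∀ {x e}, first x = some e → proj x = e.left
  proj_shift : ∀ {x e}, first x = some e → proj (shift x) = e.right
  step_shift : ∀ {x e}, first x = some e → step e (shift x) = x
  first_step : ∀ {x e}, proj x = e.right → first (step e x) = some e
  shift_step : ∀ {x e}, proj x = e.right → shift (step e x) = x
  exists_first_eq_some : ∀ x, IsRegular (proj x) → ∃ e, first x = some e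

namespace BranchingSystem

variable (K : Type*) [Field K] {V : Type u} [Quiver.{v} V] {X : Type*} (𝒳 : BranchingSystem V X)

open scoped Classical in
/-- The operator of the vertex `a`: restriction of functions to the fibre over `a`. -/
noncomputable def vertexOp (a : V) : Module.End K (X → K) where
  toFun g x := if 𝒳.proj x = a then g x else 0
  map_add' g h := by ext x; dsimp; split_ifs <;> simp
  map_smul' k g := by ext x; dsimp; split_ifs <;> simp

open scoped Classical in
/-- The operator of the arrow `e`: transport of functions along `step e`. -/
noncomputable def arrowOp (e : Quiver.Total V) : Module.End K (X → K) where
  toFun g x := if 𝒳.first x = some e then g (𝒳.shift x) else 0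
  map_add' g h := by ext x; dsimp; split_ifs <;> simp
  map_smul' k g := by ext x; dsimp; split_ifs <;> simp

open scoped Classical in
/-- The operator of the ghost arrow `e*`: composition of functions with `step e`. -/
noncomputable def ghostOp (e : Quiver.Total V) : Module.End K (X → K) where
  toFun g x := if 𝒳.proj x = e.right then g (𝒳.step e x) else 0
  map_add' g h := by ext x; dsimp; split_ifs <;> simp
  map_smul' k g := by ext x; dsimp; split_ifs <;> simp

open scoped Classical in
theorem vertexOp_apply (a : V) (g : X → K) (x : X) :
    𝒳.vertexOp K a g x = if 𝒳.proj x = a then g x else 0 := rfl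

open scoped Classical in
theorem arrowOp_apply (e : Quiver.Total V) (g : X → K) (x : X) :
    𝒳.arrowOp K e g x = if 𝒳.first x = some e then g (𝒳.shift x) else 0 := rfl

open scoped Classical in
theorem ghostOp_apply (e : Quiver.Total V) (g : X → K) (x : X) :
    𝒳.ghostOp K e g x = if 𝒳.proj x = e.right then g (𝒳.step e x) else 0 := rfl

open scoped Classical in
theorem arrowOp_ghostOp_apply (e : Quiver.Total V) (g : X → K) (x : X) :
    (𝒳.arrowOp K e * 𝒳.ghostOp K e) g x = if 𝒳.first x = some e then g x else 0 := by
  rw [Module.End.mul_apply, arrowOp_apply, ghostOp_apply]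
  split_ifs with h_first h_proj
  · rw [𝒳.step_shift h_first]
  · exact absurd (𝒳.proj_shift h_first) h_proj
  · rfl

theorem vertexOp_eq_sum {a : V} (ha : IsRegular a) :
    𝒳.vertexOp K a = ∑ e ∈ ha.2.toFinset, 𝒳.arrowOp K e * 𝒳.ghostOp K e := by
  classical
  ext g x
  simp only [LinearMap.sum_apply, Finset.sum_apply, arrowOp_ghostOp_apply, vertexOp_apply]
  split_ifs with hx
  · obtain ⟨e, he⟩ := 𝒳.exists_first_eq_some x (hx ▸ ha)
    have h_mem : e ∈ emitted a := (𝒳.proj_of_first_eq_some he).symm.trans hx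
    simp [he, h_mem]
  · refine (Finset.sum_eq_zero fun e he => if_neg fun h_first => hx ?_).symm
    exact (𝒳.proj_of_first_eq_some h_first).trans (ha.2.mem_toFinset.1 he)

theorem isLeavittFamily : IsLeavittFamily (𝒳.vertexOp K) (𝒳.arrowOp K) (𝒳.ghostOp K) := by
  have := @𝒳.proj_of_first_eq_some
  have := @𝒳.proj_shift
  have := @𝒳.step_shift
  have := @𝒳.first_step
  have := @𝒳.shift_step
  constructor
  case vertex_eq_sum => exact fun _ => 𝒳.vertexOp_eq_sum K
  all_goals
    intros
    ext g x
    simp only [Module.End.mul_apply, vertexOp_apply, arrowOp_apply, ghostOp_apply,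
      LinearMap.zero_apply, Pi.zero_apply]
    grind

open scoped Classical in
/-- The branching system on `V × F`, for a set `F` that absorbs the product with `emitted a` for
every vertex `a` which is not a sink. -/
noncomputable def ofEquiv {F : Type*}
    (θ : ∀ a : V, (emitted a).Nonempty → emitted a × F ≃ F) : BranchingSystem V (V × F) where
  proj := Prod.fst
  first x := if h : (emitted x.1).Nonempty then some ((θ x.1 h).symm x.2).1 else none
  shift x := if h : (emitted x.1).Nonempty then
    (((θ x.1 h).symm x.2).1.1.right, ((θ x.1 h).symm x.2).2) else x
  step e x := (e.left, θ e.left ⟨e, rfl⟩ (⟨e, rfl⟩, x.2))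
  proj_of_first_eq_some {x e} hx := by
    split_ifs at hx with h
    exact (Option.some.inj hx ▸ ((θ x.1 h).symm x.2).1.2).symm
  proj_shift {x e} hx := by
    split_ifs at hx ⊢ with h
    exact congrArg Quiver.Total.right (Option.some.inj hx)
  step_shift {x e} hx := by
    have h_step : ∀ {a : V} (h : (emitted a).Nonempty) (y : emitted a × F),
        (y.1.1.left, θ y.1.1.left ⟨y.1.1, rfl⟩ (⟨y.1.1, rfl⟩, y.2)) = (a, θ a h y) := by
      rintro _ _ ⟨⟨e, rfl⟩, i⟩
      rfl
    split_ifs at hx ⊢ with h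
    obtain rfl := Option.some.inj hx
    exact (h_step h _).trans (Prod.ext rfl ((θ x.1 h).apply_symm_apply x.2))
  first_step {x e} _ := by
    rw [dif_pos ⟨e, rfl⟩, Equiv.symm_apply_apply]
  shift_step {x e} hx := by
    rw [dif_pos ⟨e, rfl⟩, Equiv.symm_apply_apply]
    exact Prod.ext hx.symm rfl
  exists_first_eq_some x hx := ⟨_, dif_pos hx.1⟩

end BranchingSystem

variable {V : Type u} [Quiver.{v} V]

theorem nonempty_emitted_prod_equiv {a : V} (ha : (emitted a).Nonempty) :
    Nonempty (emitted a × (ℕ ⊕ Quiver.Total V) ≃ ℕ ⊕ Quiver.Total V) := by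
  have : Infinite (ℕ ⊕ Quiver.Total V) := inferInstance
  have := ha.to_subtype
  let embed : emitted a ↪ ℕ ⊕ Quiver.Total V := (Function.Embedding.subtype _).trans .inr
  rw [← Cardinal.eq, Cardinal.mk_prod, Cardinal.lift_id, Cardinal.lift_id]
  exact Cardinal.mul_eq_right (Cardinal.aleph0_le_mk _)
    (Cardinal.mk_le_of_injective embed.injective) (Cardinal.mk_ne_zero _)

theorem vertex_ne_zero (K : Type*) [Field K] (a : V) : vertex K a ≠ 0 := by
  let 𝒳 : BranchingSystem V (V × (ℕ ⊕ Quiver.Total V)) :=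
    .ofEquiv fun _ ha => (nonempty_emitted_prod_equiv ha).some
  intro h
  have h_op : 𝒳.vertexOp K a = 0 := by
    rw [← (𝒳.isLeavittFamily K).lift_vertex (K := K) a, h, map_zero]
  have h_apply : 𝒳.vertexOp K a 1 (a, .inl 0) = 0 := by rw [h_op]; rfl
  rw [𝒳.vertexOp_apply K] at h_apply
  exact one_ne_zero ((if_pos rfl).symm.trans h_apply)

end Branching

section Derivation

variable {K : Type*} [Field K] {V : Type u} [Quiver.{v} V]

theorem arrow_ne_zero (K : Type*) [Field K] (e : Quiver.Total V) : arrow K e ≠ 0 := fun h =>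
  vertex_ne_zero K e.right <| by rw [← ghost_mul_arrow_self, h, mul_zero]

/- The matrices below are the values of `x ↦ !![x, D x; 0, x]` for the derivation `D` with
`D a = 0`, `D e = w e • e` and `D e* = - w e • e*`. -/
theorem isLeavittFamily_weighted (w : Quiver.Total V → K) :
    IsLeavittFamily (fun a : V => !![vertex K a, 0; 0, vertex K a])
      (fun e => !![arrow K e, w e • arrow K e; 0, arrow K e])
      (fun e => !![ghost K e, -w e • ghost K e; 0, ghost K e]) where
  vertex_mul_self a := by simp [vertex_mul_self]
  vertex_mul_vertex a b hab := by simp [vertex_mul_vertex_of_ne hab, ← Matrix.ext_iff]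
  left_mul_arrow e := by simp [left_mul_arrow, mul_smul_comm]
  arrow_mul_right e := by simp [arrow_mul_right]
  right_mul_ghost e := by simp [right_mul_ghost, mul_smul_comm]
  ghost_mul_left e := by simp [ghost_mul_left, smul_mul_assoc]
  ghost_mul_arrow_self e := by simp [ghost_mul_arrow_self, smul_mul_assoc, mul_smul_comm]
  ghost_mul_arrow e f hef := by
    simp [ghost_mul_arrow_of_ne hef, smul_mul_assoc, mul_smul_comm, ← Matrix.ext_iff]
  vertex_eq_sum a ha := by
    ext i j
    fin_cases i <;> fin_cases j <;> simp [Matrix.sum_apply, vertex_eq_sum ha, mul_smul_comm]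

theorem mem_of_arrow_mem_adjoin {E : Set (Quiver.Total V)} {e : Quiver.Total V}
    (he : arrow K e ∈ NonUnitalAlgebra.adjoin K
      (Set.range (vertex K) ∪ arrow K '' E ∪ ghost K '' E)) : e ∈ E := by
  classical
  by_contra heE
  let w : Quiver.Total V → K := Pi.single e 1
  have hw : ∀ f ∈ E, w f = 0 := fun f hf =>
    Pi.single_eq_of_ne (ne_of_mem_of_not_mem hf heE) 1
  let weighted := (isLeavittFamily_weighted w).lift K
  let unweighted := (isLeavittFamily_weighted (0 : Quiver.Total V → K)).lift K
  have h_le : NonUnitalAlgebra.adjoin K (Set.range (vertex K) ∪ arrow K '' E ∪ ghost K '' E) ≤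
      NonUnitalAlgHom.equalizer weighted unweighted := by
    rw [NonUnitalAlgebra.adjoin_le_iff]
    rintro _ ((⟨a, rfl⟩ | ⟨f, hf, rfl⟩) | ⟨f, hf, rfl⟩)
    · simp [weighted, unweighted]
    · simp [weighted, unweighted, hw f hf]
    · simp [weighted, unweighted, hw f hf]
  have h_eq : weighted (arrow K e) = unweighted (arrow K e) := h_le he
  simp [weighted, unweighted, w, arrow_ne_zero] at h_eq

end Derivation

section Paths

variable {K : Type*} [Field K] {V : Type u} [Quiver.{v} V] {a b c d : V}

theorem vertex_mul_pathElt (α : Quiver.Path a b) :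
    vertex K a * pathElt K α = pathElt K α := by
  induction α with
  | nil => exact vertex_mul_self a
  | cons α e ih => rw [pathElt, ← mul_assoc, ih]

theorem pathElt_mul_vertex (α : Quiver.Path a b) :
    pathElt K α * vertex K b = pathElt K α := by
  cases α with
  | nil => exact vertex_mul_self a
  | cons α e => rw [pathElt, mul_assoc, arrow_mul_right ⟨_, _, e⟩]

theorem pathElt_comp (α : Quiver.Path a b) (β : Quiver.Path b c) :
    pathElt K (α.comp β) = pathElt K α * pathElt K β := by
  induction β with
  | nil => exact (pathElt_mul_vertex α).symm
  | cons β e ih => rw [Quiver.Path.comp_cons, pathElt, ih, mul_assoc, ← pathElt]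

theorem pathElt_toPath (e : Quiver.Total V) : pathElt K e.hom.toPath = arrow K e :=
  left_mul_arrow e

open MulOpposite in
theorem isLeavittFamily_op : IsLeavittFamily (fun a : V => op (vertex K a))
    (fun e => op (ghost K e)) (fun e => op (arrow K e)) where
  vertex_mul_self a := by rw [← op_mul, vertex_mul_self]
  vertex_mul_vertex a b hab := by rw [← op_mul, vertex_mul_vertex_of_ne hab.symm, op_zero]
  left_mul_arrow e := by rw [← op_mul, ghost_mul_left]
  arrow_mul_right e := by rw [← op_mul, right_mul_ghost]
  right_mul_ghost e := by rw [← op_mul, arrow_mul_right]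
  ghost_mul_left e := by rw [← op_mul, left_mul_arrow]
  ghost_mul_arrow_self e := by rw [← op_mul, ghost_mul_arrow_self]
  ghost_mul_arrow e f hef := by rw [← op_mul, ghost_mul_arrow_of_ne hef.symm, op_zero]
  vertex_eq_sum a ha := by simp only [vertex_eq_sum ha, ← op_mul, Finset.op_sum]

variable (K V) in
/-- The involution of `L_K(Q)`: the anti-automorphism that fixes the vertices and exchanges `e`
and `e*`. -/
noncomputable def involution : LeavittPathAlgebra K V →ₗ[K] LeavittPathAlgebra K V :=
  (MulOpposite.opLinearEquiv K).symm.toLinearMap ∘ₗ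
    (isLeavittFamily_op (K := K) (V := V)).lift K

theorem involution_mul (x y : LeavittPathAlgebra K V) :
    involution K V (x * y) = involution K V y * involution K V x := by
  simp [involution]

@[simp] theorem involution_vertex (a : V) : involution K V (vertex K a) = vertex K a := by
  simp [involution]

@[simp] theorem involution_arrow (e : Quiver.Total V) :
    involution K V (arrow K e) = ghost K e := by
  simp [involution]

@[simp] theorem involution_ghost (e : Quiver.Total V) :
    involution K V (ghost K e) = arrow K e := by
  simp [involution]

theorem involution_pathElt (α : Quiver.Path a b) :
    involution K V (pathElt K α) = ghostPathElt K α := by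
  induction α with
  | nil => exact involution_vertex a
  | cons α e ih => rw [pathElt, involution_mul, ih, involution_arrow, ghostPathElt]

theorem involution_ghostPathElt (α : Quiver.Path a b) :
    involution K V (ghostPathElt K α) = pathElt K α := by
  induction α with
  | nil => exact involution_vertex a
  | cons α e ih => rw [ghostPathElt, involution_mul, ih, involution_ghost, pathElt]

theorem vertex_mul_ghostPathElt (α : Quiver.Path a b) :
    vertex K b * ghostPathElt K α = ghostPathElt K α := by
  simpa only [involution_mul, involution_pathElt, involution_vertex] using
    congrArg (involution K V) (pathElt_mul_vertex (K := K) α)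

theorem ghostPathElt_mul_vertex (α : Quiver.Path a b) :
    ghostPathElt K α * vertex K a = ghostPathElt K α := by
  simpa only [involution_mul, involution_pathElt, involution_vertex] using
    congrArg (involution K V) (vertex_mul_pathElt (K := K) α)

theorem ghostPathElt_mul_pathElt_self (α : Quiver.Path a b) :
    ghostPathElt K α * pathElt K α = vertex K b := by
  induction α with
  | nil => exact vertex_mul_self a
  | @cons b c α e ih =>
    rw [ghostPathElt, pathElt, mul_assoc, ← mul_assoc (ghostPathElt K α), ih,
      left_mul_arrow ⟨b, c, e⟩, ghost_mul_arrow_self]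

variable (K) in
/-- The monomial `α β*`. -/
noncomputable def monomial (α : Quiver.Path a c) (β : Quiver.Path b c) :
    LeavittPathAlgebra K V :=
  pathElt K α * ghostPathElt K β

theorem involution_monomial (α : Quiver.Path a c) (β : Quiver.Path b c) :
    involution K V (monomial K α β) = monomial K β α := by
  rw [monomial, involution_mul, involution_pathElt, involution_ghostPathElt, monomial]

theorem monomial_nil (α : Quiver.Path a b) : monomial K α .nil = pathElt K α :=
  pathElt_mul_vertex α

theorem monomial_mul_vertex (α : Quiver.Path a c) (β : Quiver.Path b c) :
    monomial K α β * vertex K b = monomial K α β := by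
  rw [monomial, mul_assoc, ghostPathElt_mul_vertex]

theorem vertex_mul_monomial (α : Quiver.Path a c) (β : Quiver.Path b c) :
    vertex K a * monomial K α β = monomial K α β := by
  rw [monomial, ← mul_assoc, vertex_mul_pathElt]

theorem arrow_mul_monomial (e : Quiver.Total V) (α : Quiver.Path e.right c)
    (β : Quiver.Path b c) :
    arrow K e * monomial K α β = monomial K (e.hom.toPath.comp α) β := by
  rw [monomial, monomial, pathElt_comp, pathElt_toPath, mul_assoc]

theorem arrow_mul_monomial_of_ne {e : Quiver.Total V} (α : Quiver.Path a c)
    (β : Quiver.Path b c) (h : e.right ≠ a) : arrow K e * monomial K α β = 0 := by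
  rw [← arrow_mul_right, ← vertex_mul_monomial, mul_assoc, ← mul_assoc (vertex K _),
    vertex_mul_vertex_of_ne h, zero_mul, mul_zero]

theorem ghost_mul_arrow_mul_monomial (e : Quiver.Total V) (α : Quiver.Path e.right c)
    (β : Quiver.Path b c) : ghost K e * (arrow K e * monomial K α β) = monomial K α β := by
  rw [← mul_assoc, ghost_mul_arrow_self, vertex_mul_monomial]

theorem ghost_mul_monomial_nil (e : Quiver.Total V) (β : Quiver.Path b e.left) :
    ghost K e * monomial K .nil β = monomial K .nil (β.cons e.hom) := by
  rw [monomial, monomial, pathElt, pathElt, vertex_mul_ghostPathElt, vertex_mul_ghostPathElt,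
    ghostPathElt]

theorem ghost_mul_monomial_of_ne {e : Quiver.Total V} (α : Quiver.Path a c)
    (β : Quiver.Path b c) (h : e.left ≠ a) : ghost K e * monomial K α β = 0 := by
  rw [← ghost_mul_left, ← vertex_mul_monomial, mul_assoc, ← mul_assoc (vertex K _),
    vertex_mul_vertex_of_ne h, zero_mul, mul_zero]

end Paths

section Grading

variable {K : Type*} [Field K] {V : Type u} [Quiver.{v} V] {a b c : V} {n : ℤ}

theorem monomial_mem_component (α : Quiver.Path a c) (β : Quiver.Path b c)
    (hn : (α.length : ℤ) - β.length = n) : monomial K α β ∈ component K V n :=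
  Submodule.subset_span ⟨a, b, c, α, β, hn, rfl⟩

theorem component_le {p : Submodule K (LeavittPathAlgebra K V)}
    (h : ∀ {a b c : V} (α : Quiver.Path a c) (β : Quiver.Path b c),
      (α.length : ℤ) - β.length = n → monomial K α β ∈ p) : component K V n ≤ p := by
  refine Submodule.span_le.2 ?_
  rintro _ ⟨a, b, c, α, β, hn, rfl⟩
  exact h α β hn

theorem vertex_mem_component (a : V) : vertex K a ∈ component K V 0 := by
  have h := monomial_mem_component (K := K) (.nil : Quiver.Path a a) .nil (sub_self _)
  rwa [monomial_nil] at h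

theorem arrow_mem_component (e : Quiver.Total V) : arrow K e ∈ component K V 1 := by
  have h := monomial_mem_component (K := K) e.hom.toPath .nil (n := 1) (by simp)
  rwa [monomial_nil, pathElt_toPath] at h

theorem involution_mem_component {x : LeavittPathAlgebra K V} (hx : x ∈ component K V n) :
    involution K V x ∈ component K V (-n) := by
  suffices component K V n ≤ (component K V (-n)).comap (involution K V) from this hx
  refine component_le fun α β hn => ?_
  rw [Submodule.mem_comap, involution_monomial]
  exact monomial_mem_component β α (by omega)

theorem ghost_mem_component (e : Quiver.Total V) : ghost K e ∈ component K V (-1) :=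
  involution_arrow (K := K) e ▸ involution_mem_component (arrow_mem_component e)

theorem vertex_mul_mem_component (a : V) {x : LeavittPathAlgebra K V}
    (hx : x ∈ component K V n) : vertex K a * x ∈ component K V n := by
  suffices component K V n ≤ (component K V n).comap (LinearMap.mulLeft K (vertex K a)) from
    this hx
  refine component_le @fun b _ _ α β hn => ?_
  rw [Submodule.mem_comap, LinearMap.mulLeft_apply]
  obtain rfl | hab := eq_or_ne a b
  · rw [vertex_mul_monomial]
    exact monomial_mem_component α β hn
  · rw [← vertex_mul_monomial, ← mul_assoc, vertex_mul_vertex_of_ne hab, zero_mul]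
    exact zero_mem _

theorem arrow_mul_mem_component (e : Quiver.Total V) {x : LeavittPathAlgebra K V}
    (hx : x ∈ component K V n) : arrow K e * x ∈ component K V (n + 1) := by
  suffices component K V n ≤ (component K V (n + 1)).comap (LinearMap.mulLeft K (arrow K e)) from
    this hx
  refine component_le @fun a _ _ α β hn => ?_
  rw [Submodule.mem_comap, LinearMap.mulLeft_apply]
  obtain rfl | he := eq_or_ne e.right a
  · rw [arrow_mul_monomial]
    refine monomial_mem_component _ β ?_
    rw [Quiver.Path.length_comp, Quiver.Path.length_toPath]
    omega
  · rw [arrow_mul_monomial_of_ne α β he]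
    exact zero_mem _

theorem ghost_mul_mem_component (e : Quiver.Total V) {x : LeavittPathAlgebra K V}
    (hx : x ∈ component K V n) : ghost K e * x ∈ component K V (n - 1) := by
  suffices component K V n ≤ (component K V (n - 1)).comap (LinearMap.mulLeft K (ghost K e)) from
    this hx
  refine component_le @fun a _ _ α β hn => ?_
  rw [Submodule.mem_comap, LinearMap.mulLeft_apply]
  obtain h_len | h_len := eq_or_ne α.length 0
  · obtain rfl := α.eq_of_length_zero h_len
    obtain rfl := α.eq_nil_of_length_zero h_len
    obtain rfl | he := eq_or_ne e.left a
    · rw [ghost_mul_monomial_nil]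
      refine monomial_mem_component _ _ ?_
      rw [← hn, Quiver.Path.length_cons, Quiver.Path.length_nil, Quiver.Path.length_nil]
      push_cast
      ring
    · rw [ghost_mul_monomial_of_ne _ β he]
      exact zero_mem _
  · obtain ⟨d, f, α, rfl, h_len⟩ :=
      (Quiver.Path.length_ne_zero_iff_eq_comp α).1 h_len
    rw [← arrow_mul_monomial ⟨a, d, f⟩]
    obtain rfl | hef := eq_or_ne e ⟨a, d, f⟩
    · rw [ghost_mul_arrow_mul_monomial]
      exact monomial_mem_component α β (by omega)
    · rw [← mul_assoc, ghost_mul_arrow_of_ne hef, zero_mul]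
      exact zero_mem _

theorem pathElt_mul_mem_component (α : Quiver.Path a b) {n : ℤ} {x : LeavittPathAlgebra K V}
    (hx : x ∈ component K V n) : pathElt K α * x ∈ component K V (α.length + n) := by
  induction α generalizing n x with
  | nil => simpa [pathElt] using vertex_mul_mem_component a hx
  | cons α e ih =>
    rw [pathElt, mul_assoc]
    convert ih (arrow_mul_mem_component ⟨_, _, e⟩ hx) using 1
    rw [Quiver.Path.length_cons]
    push_cast
    ring_nf

theorem ghostPathElt_mul_mem_component (α : Quiver.Path a b) {n : ℤ}
    {x : LeavittPathAlgebra K V} (hx : x ∈ component K V n) :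
    ghostPathElt K α * x ∈ component K V (n - α.length) := by
  induction α with
  | nil => simpa [ghostPathElt] using vertex_mul_mem_component a hx
  | cons α e ih =>
    rw [ghostPathElt, mul_assoc]
    convert ghost_mul_mem_component ⟨_, _, e⟩ ih using 1
    rw [Quiver.Path.length_cons]
    push_cast
    ring_nf

instance : SetLike.GradedMul (component K V) where
  mul_mem {m n x y} hx hy := by
    suffices component K V m ≤ (component K V (m + n)).comap (LinearMap.mulRight K y) from this hx
    refine component_le fun α β hm => ?_
    rw [Submodule.mem_comap, LinearMap.mulRight_apply, monomial, mul_assoc]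
    convert pathElt_mul_mem_component α (ghostPathElt_mul_mem_component β hy) using 1
    rw [← hm]
    ring_nf

theorem mul_mem_iSup {ι R A : Type*} [Add ι] [CommSemiring R] [NonUnitalNonAssocSemiring A]
    [Module R A] [IsScalarTower R A A] [SMulCommClass R A A] (𝒜 : ι → Submodule R A)
    [SetLike.GradedMul 𝒜] {x y : A}
    (hx : x ∈ ⨆ n, 𝒜 n) (hy : y ∈ ⨆ n, 𝒜 n) : x * y ∈ ⨆ n, 𝒜 n := by
  suffices ⨆ m, 𝒜 m ≤ (⨆ n, 𝒜 n).comap (LinearMap.mulRight R y) from this hx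
  refine iSup_le fun m x hx => ?_
  suffices ⨆ n, 𝒜 n ≤ (⨆ n, 𝒜 n).comap (LinearMap.mulLeft R x) from this hy
  exact iSup_le fun n y hy => Submodule.mem_iSup_of_mem (m + n) (SetLike.mul_mem_graded hx hy)

theorem iSup_component : ⨆ n, component K V n = ⊤ := by
  refine eq_top_iff.2 fun x _ => ?_
  have hx : x ∈ NonUnitalAlgebra.adjoin K (generators K V) :=
    adjoin_generators (K := K) (V := V) ▸ NonUnitalAlgebra.mem_top
  induction hx using NonUnitalAlgebra.adjoin_induction with
  | mem x hx =>
    obtain (⟨a, rfl⟩ | ⟨e, rfl⟩) | ⟨e, rfl⟩ := hx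
    exacts [Submodule.mem_iSup_of_mem 0 (vertex_mem_component a),
      Submodule.mem_iSup_of_mem 1 (arrow_mem_component e),
      Submodule.mem_iSup_of_mem (-1) (ghost_mem_component e)]
  | zero => exact zero_mem _
  | add x y _ _ hx hy => exact add_mem (hx trivial) (hy trivial)
  | mul x y _ _ hx hy => exact mul_mem_iSup _ (hx trivial) (hy trivial)
  | smul k x _ hx => exact Submodule.smul_mem _ k (hx trivial)

theorem eq_top_of_monomial_mem {p : Submodule K (LeavittPathAlgebra K V)}
    (h : ∀ {a b c : V} (α : Quiver.Path a c) (β : Quiver.Path b c), monomial K α β ∈ p) :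
    p = ⊤ :=
  top_le_iff.1 <| iSup_component (K := K) (V := V) ▸
    iSup_le fun _ => component_le fun α β _ => h α β

theorem involution_involution : Function.Involutive (involution K V) := by
  have h_top : LinearMap.eqLocus (involution K V ∘ₗ involution K V) LinearMap.id = ⊤ :=
    eq_top_of_monomial_mem fun α β => by
      simp only [LinearMap.mem_eqLocus, LinearMap.comp_apply, involution_monomial,
        LinearMap.id_apply]
  exact LinearMap.congr_fun (LinearMap.eqLocus_eq_top.1 h_top)

theorem map_mem_of_mem_component {B : Type*} [NonUnitalSemiring B] [Module K B]
    {ℬ : ℤ → Submodule K B} [SetLike.GradedMul ℬ] {f : LeavittPathAlgebra K V →ₙₐ[K] B}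
    (hvertex : ∀ a, f (vertex K a) ∈ ℬ 0) (harrow : ∀ e, f (arrow K e) ∈ ℬ 1)
    (hghost : ∀ e, f (ghost K e) ∈ ℬ (-1)) {x : LeavittPathAlgebra K V}
    (hx : x ∈ component K V n) : f x ∈ ℬ n := by
  have h_path {a b : V} (α : Quiver.Path a b) : f (pathElt K α) ∈ ℬ α.length := by
    induction α with
    | nil => exact hvertex a
    | cons α e ih =>
      rw [pathElt, map_mul, Quiver.Path.length_cons]
      push_cast
      exact SetLike.mul_mem_graded ih (harrow _)
  have h_ghost {a b : V} (α : Quiver.Path a b) : f (ghostPathElt K α) ∈ ℬ (-α.length) := by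
    induction α with
    | nil => exact hvertex a
    | cons α e ih =>
      rw [ghostPathElt, map_mul, Quiver.Path.length_cons]
      push_cast
      rw [neg_add_rev]
      exact SetLike.mul_mem_graded (hghost _) ih
  suffices component K V n ≤ (ℬ n).comap (f : LeavittPathAlgebra K V →ₗ[K] B) from this hx
  refine component_le fun α β hn => ?_
  rw [← hn, sub_eq_add_neg]
  have h_mul := SetLike.mul_mem_graded (h_path α) (h_ghost β)
  rwa [← map_mul] at h_mul

end Grading

section GradedIdeals

variable {K A : Type*} [Field K] [NonUnitalRing A] [Module K A] {𝒜 : ℤ → Submodule K A}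
  {I : Submodule K A}

theorem IsHomogeneous.exists_mem_ne_zero (hI : IsHomogeneous 𝒜 I) (h_bot : I ≠ ⊥) :
    ∃ n, ∃ x ∈ I, x ∈ 𝒜 n ∧ x ≠ 0 := by
  by_contra! h
  refine h_bot (le_bot_iff.1 (hI.trans (iSup_le fun n x hx => ?_)))
  exact h n x hx.1 hx.2

/-- An involution of a graded algebra: an anti-automorphism of order two which reverses the
grading. It turns left ideals into right ideals. -/
structure IsGradedInvolution (𝒜 : ℤ → Submodule K A) (τ : A →ₗ[K] A) : Prop where
  involutive : Function.Involutive τ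
  map_mul : ∀ x y, τ (x * y) = τ y * τ x
  map_mem : ∀ {n x}, x ∈ 𝒜 n → τ x ∈ 𝒜 (-n)

namespace IsGradedInvolution

variable {τ : A →ₗ[K] A} (hτ : IsGradedInvolution 𝒜 τ)
include hτ

/-- The automorphism of the lattice of subspaces that an involution induces. -/
def comapOrderIso : Submodule K A ≃o Submodule K A where
  toFun := Submodule.comap τ
  invFun := Submodule.comap τ
  left_inv I := by ext x; simp [hτ.involutive x]
  right_inv I := by ext x; simp [hτ.involutive x]
  map_rel_iff' := by
    refine ⟨fun h x hx => ?_, Submodule.comap_mono⟩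
    have h_mem : τ x ∈ Submodule.comap τ _ := h (by simpa [hτ.involutive x] using hx)
    simpa [hτ.involutive x] using h_mem

theorem mem_comapOrderIso {x : A} : x ∈ hτ.comapOrderIso I ↔ τ x ∈ I := Iff.rfl

theorem comapOrderIso_comapOrderIso (I : Submodule K A) :
    hτ.comapOrderIso (hτ.comapOrderIso I) = I := hτ.comapOrderIso.symm_apply_apply I

theorem isRightIdeal_comapOrderIso (hI : IsLeftIdeal I) : IsRightIdeal (hτ.comapOrderIso I) :=
  fun a x hx => by
    rw [hτ.mem_comapOrderIso, hτ.map_mul]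
    exact hI (τ a) (τ x) hx

theorem isLeftIdeal_comapOrderIso (hI : IsRightIdeal I) : IsLeftIdeal (hτ.comapOrderIso I) :=
  fun a x hx => by
    rw [hτ.mem_comapOrderIso, hτ.map_mul]
    exact hI (τ a) (τ x) hx

theorem isHomogeneous_comapOrderIso (hI : IsHomogeneous 𝒜 I) :
    IsHomogeneous 𝒜 (hτ.comapOrderIso I) := by
  refine (hτ.comapOrderIso.monotone hI).trans ?_
  rw [OrderIso.map_iSup]
  refine iSup_le fun n x hx => Submodule.mem_iSup_of_mem (-n) ⟨hx.1, ?_⟩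
  have h_mem : τ (τ x) ∈ 𝒜 (-n) := hτ.map_mem hx.2
  rwa [hτ.involutive x] at h_mem

theorem isGradedSimpleRight_comapOrderIso (hI : IsGradedSimpleLeft 𝒜 I) :
    IsGradedSimpleRight 𝒜 (hτ.comapOrderIso I) where
  isRightIdeal := hτ.isRightIdeal_comapOrderIso hI.isLeftIdeal
  isHomogeneous := hτ.isHomogeneous_comapOrderIso hI.isHomogeneous
  mul_ne_zero := by
    obtain ⟨a, x, hx, hax⟩ := hI.mul_ne_zero
    refine ⟨τ a, τ x, ?_, ?_⟩
    · rwa [hτ.mem_comapOrderIso, hτ.involutive x]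
    · rwa [← hτ.map_mul, ne_eq, hτ.involutive.injective.eq_iff' τ.map_zero]
  eq_bot_or_eq J hJ hJ_right hJ_hom := by
    have hJ_le : hτ.comapOrderIso J ≤ I := by
      simpa only [hτ.comapOrderIso_comapOrderIso] using hτ.comapOrderIso.monotone hJ
    refine (hI.eq_bot_or_eq _ hJ_le (hτ.isLeftIdeal_comapOrderIso hJ_right)
      (hτ.isHomogeneous_comapOrderIso hJ_hom)).imp (map_eq_bot_iff _).1 fun h => ?_
    rw [← h, hτ.comapOrderIso_comapOrderIso]

theorem isGradedSemisimple {ι : Type*} {I : ι → Submodule K A}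
    (h_simple : ∀ i, IsGradedSimpleLeft 𝒜 (I i)) (h_indep : iSupIndep I) (h_top : ⨆ i, I i = ⊤) :
    IsGradedSemisimple 𝒜 := by
  refine ⟨⟨Set.range I, Set.forall_mem_range.2 h_simple, h_indep.sSupIndep_range, h_top⟩,
    Set.range (hτ.comapOrderIso ∘ I), Set.forall_mem_range.2 fun i =>
      hτ.isGradedSimpleRight_comapOrderIso (h_simple i), ?_, ?_⟩
  · exact (h_indep.map_orderIso hτ.comapOrderIso).sSupIndep_range
  · rw [sSup_range, ← hτ.comapOrderIso.map_top, ← h_top, OrderIso.map_iSup]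
    rfl

end IsGradedInvolution

end GradedIdeals

section Splitting

variable {K A : Type*} [Field K] [NonUnitalRing A] [Module K A] {𝒜 : ℤ → Submodule K A}
  {I : Submodule K A}

/-- A graded retraction of `A` onto the subspace `I`: a degree-preserving algebra endomorphism
with values in `I` that is the identity on `I`. -/
structure IsGradedRetraction (𝒜 : ℤ → Submodule K A) (I : Submodule K A) (π : A →ₙₐ[K] A) :
    Prop where
  map_mem : ∀ x, π x ∈ I
  map_eq_self : ∀ {x}, x ∈ I → π x = x
  map_mem_component : ∀ {n x}, x ∈ 𝒜 n → π x ∈ 𝒜 n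

namespace IsGradedRetraction

variable {π : A →ₙₐ[K] A} (hπ : IsGradedRetraction 𝒜 I π)
include hπ

/-- The section `x + I ↦ x - π x` of the projection `A → A / I`. -/
def quotientSection : (A ⧸ I) →ₗ[K] A :=
  I.liftQ (LinearMap.id - (π : A →ₗ[K] A)) fun x hx => by
    rw [LinearMap.mem_ker]
    exact sub_eq_zero.2 (hπ.map_eq_self hx).symm

theorem quotientSection_mkQ (x : A) : hπ.quotientSection (I.mkQ x) = x - π x := rfl

theorem mkQ_quotientSection (y : A ⧸ I) : I.mkQ (hπ.quotientSection y) = y := by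
  obtain ⟨x, rfl⟩ := I.mkQ_surjective y
  rw [quotientSection_mkQ, map_sub, sub_eq_self]
  exact (Submodule.Quotient.mk_eq_zero I).2 (hπ.map_mem x)

theorem quotientSection_mem {n : ℤ} {x : A} (hx : x ∈ 𝒜 n) :
    hπ.quotientSection (I.mkQ x) ∈ 𝒜 n :=
  sub_mem hx (hπ.map_mem_component hx)

theorem isHomogeneous (h_top : ⨆ n, 𝒜 n = ⊤) : IsHomogeneous 𝒜 I := fun x hx => by
  have h_le : ⨆ n, 𝒜 n ≤ (⨆ n, I ⊓ 𝒜 n).comap (π : A →ₗ[K] A) := iSup_le fun n y hy =>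
    Submodule.mem_iSup_of_mem n ⟨hπ.map_mem y, hπ.map_mem_component hy⟩
  rw [← hπ.map_eq_self hx]
  exact h_le (h_top ▸ Submodule.mem_top)

theorem map_mul_of_isLeftIdeal (hI : IsLeftIdeal I) (a x : A) : π (a * x) = a * π x :=
  calc π (a * x) = π a * π (π x) := by rw [hπ.map_eq_self (hπ.map_mem x), map_mul]
    _ = π (a * π x) := (map_mul π a (π x)).symm
    _ = a * π x := hπ.map_eq_self (hI a _ (hπ.map_mem x))

theorem map_mul_of_isRightIdeal (hI : IsRightIdeal I) (x a : A) : π (x * a) = π x * a :=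
  calc π (x * a) = π (π x) * π a := by rw [hπ.map_eq_self (hπ.map_mem x), map_mul]
    _ = π (π x * a) := (map_mul π (π x) a).symm
    _ = π x * a := hπ.map_eq_self (hI a _ (hπ.map_mem x))

theorem splitsLeft (hI : IsLeftIdeal I) : SplitsLeft 𝒜 I :=
  ⟨hπ.quotientSection, hπ.mkQ_quotientSection,
    fun a x => by simp only [quotientSection_mkQ, hπ.map_mul_of_isLeftIdeal hI, mul_sub],
    fun _ _ hx => hπ.quotientSection_mem hx⟩

theorem splitsRight (hI : IsRightIdeal I) : SplitsRight 𝒜 I :=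
  ⟨hπ.quotientSection, hπ.mkQ_quotientSection,
    fun a x => by simp only [quotientSection_mkQ, hπ.map_mul_of_isRightIdeal hI, sub_mul],
    fun _ _ hx => hπ.quotientSection_mem hx⟩

end IsGradedRetraction

end Splitting

section NoBifurcations

/-- Every vertex emits at most one arrow. -/
def NoBifurcations (V : Type u) [Quiver.{v} V] : Prop := ∀ a : V, ¬ IsBifurcation a

namespace NoBifurcations

variable {V : Type u} [Quiver.{v} V] (hV : NoBifurcations V) {a b c d : V}
include hV

theorem eq_of_left_eq {e f : Quiver.Total V} (h : e.left = f.left) : e = f :=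
  Set.not_nontrivial_iff.1 (hV f.left) h rfl

theorem exists_eq_comp (p : Quiver.Path a b) (q : Quiver.Path a c) (h : q.length ≤ p.length) :
    ∃ r : Quiver.Path c b, p = q.comp r := by
  induction hn : q.length generalizing a with
  | zero =>
    obtain rfl := q.eq_of_length_zero hn
    exact ⟨p, by rw [q.eq_nil_of_length_zero hn, Quiver.Path.nil_comp]⟩
  | succ n ih =>
    obtain ⟨x, e, p, rfl, -⟩ := (Quiver.Path.length_ne_zero_iff_eq_comp p).1 (by omega)
    obtain ⟨y, f, q, rfl, -⟩ := (Quiver.Path.length_ne_zero_iff_eq_comp q).1 (by omega)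
    cases hV.eq_of_left_eq (e := ⟨a, x, e⟩) (f := ⟨a, y, f⟩) rfl
    simp only [Quiver.Path.length_comp, Quiver.Path.length_toPath] at h hn
    obtain ⟨r, rfl⟩ := ih p q (by omega) (by omega)
    exact ⟨r, (Quiver.Path.comp_assoc _ _ _).symm⟩

theorem eq_of_length_eq (p q : Quiver.Path a b) (h : p.length = q.length) : p = q := by
  obtain ⟨r, rfl⟩ := hV.exists_eq_comp p q h.ge
  rw [Quiver.Path.length_comp] at h
  rw [r.eq_nil_of_length_zero (by omega), Quiver.Path.comp_nil]

theorem right_eq_of_length_eq (p : Quiver.Path a b) (q : Quiver.Path a c)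
    (h : p.length = q.length) : b = c := by
  obtain ⟨r, rfl⟩ := hV.exists_eq_comp p q h.ge
  rw [Quiver.Path.length_comp] at h
  exact (r.eq_of_length_zero (by omega)).symm

theorem exists_length_lt (p : Quiver.Path a b) (c : Quiver.Path b b) (hc : 0 < c.length)
    (q : Quiver.Path a d) : ∃ q' : Quiver.Path a d, q'.length < p.length + c.length := by
  induction hn : q.length using Nat.strong_induction_on generalizing q with
  | _ n ih =>
    obtain hlt | hle := lt_or_ge q.length (p.length + c.length)
    · exact ⟨q, hlt⟩
    · obtain ⟨r, rfl⟩ := hV.exists_eq_comp q (p.comp c) (by rwa [Quiver.Path.length_comp])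
      simp only [Quiver.Path.length_comp] at hn
      exact ih _ (by rw [Quiver.Path.length_comp]; omega) (p.comp r) rfl

theorem finite_tree (p : Quiver.Path a b) (c : Quiver.Path b b) (hc : 0 < c.length) :
    (tree a).Finite := by
  choose q hq using fun x : tree a => hV.exists_length_lt p c hc x.2.some
  refine Finite.of_injective (fun x => (⟨(q x).length, hq x⟩ : Fin (p.length + c.length))) ?_
  exact fun x y hxy => Subtype.ext (hV.right_eq_of_length_eq (q x) (q y) (Fin.mk.inj hxy))

theorem isRayPoint_or_isLaurentVertex (a : V) : IsRayPoint a ∨ IsLaurentVertex a := by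
  by_cases h : ∃ b ∈ tree a, ∃ c : Quiver.Path b b, IsCycle c
  · obtain ⟨b, ⟨p⟩, c, hc⟩ := h
    refine .inr ⟨hV.finite_tree p c hc.1, fun x _ => hV x, b, ⟨p⟩, c, hc, ?_⟩
    rintro ⟨e, -, f, hf, hfe⟩
    exact hfe (hV.eq_of_left_eq hf)
  · push Not at h
    exact .inl fun b hb => ⟨hV b, h b hb⟩

theorem emitted_left (e : Quiver.Total V) : emitted e.left = {e} :=
  Set.eq_singleton_iff_unique_mem.2 ⟨rfl, fun _ hf => hV.eq_of_left_eq hf⟩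

theorem sum_emitted {M : Type*} [AddCommMonoid M] (f : Quiver.Total V → M) (e : Quiver.Total V)
    (h : (emitted e.left).Finite) : ∑ e' ∈ h.toFinset, f e' = f e := by
  rw [← Finset.sum_singleton f e]
  congr
  rw [← Finset.coe_inj, Set.Finite.coe_toFinset, hV.emitted_left, Finset.coe_singleton]

variable {K : Type*} [Field K]

theorem arrow_mul_ghost (e : Quiver.Total V) : arrow K e * ghost K e = vertex K e.left := by
  have h_regular : IsRegular e.left := by
    rw [IsRegular, hV.emitted_left]
    exact ⟨Set.singleton_nonempty e, Set.finite_singleton e⟩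
  rw [vertex_eq_sum h_regular, hV.sum_emitted]

theorem pathElt_mul_ghostPathElt (α : Quiver.Path a b) :
    pathElt K α * ghostPathElt K α = vertex K a := by
  induction α with
  | nil => exact vertex_mul_self a
  | cons α e ih =>
    rw [pathElt, ghostPathElt, mul_assoc, ← mul_assoc (arrow K _), hV.arrow_mul_ghost,
      vertex_mul_ghostPathElt, ih]

theorem monomial_mul_monomial (α : Quiver.Path a c) (β : Quiver.Path b c) :
    monomial K α β * monomial K β α = vertex K a := by
  rw [monomial, monomial, mul_assoc, ← mul_assoc (ghostPathElt K β),
    ghostPathElt_mul_pathElt_self, vertex_mul_ghostPathElt, hV.pathElt_mul_ghostPathElt]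

theorem monomial_comp (α : Quiver.Path a c) (β : Quiver.Path b c) (γ : Quiver.Path c d) :
    monomial K (α.comp γ) (β.comp γ) = monomial K α β := by
  have h_ghost : ghostPathElt K (β.comp γ) = ghostPathElt K γ * ghostPathElt K β := by
    simp only [← involution_pathElt, pathElt_comp, involution_mul]
  rw [monomial, monomial, pathElt_comp, h_ghost, mul_assoc, ← mul_assoc (pathElt K γ),
    hV.pathElt_mul_ghostPathElt, vertex_mul_ghostPathElt]

theorem monomial_eq (α : Quiver.Path a c) (β : Quiver.Path b c) (α' : Quiver.Path a d)
    (β' : Quiver.Path b d) (h : (α.length : ℤ) - β.length = α'.length - β'.length) :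
    monomial K α β = monomial K α' β' := by
  wlog hle : α.length ≤ α'.length generalizing c d
  · exact (this α' β' α β h.symm (by omega)).symm
  obtain ⟨γ, rfl⟩ := hV.exists_eq_comp α' α hle
  obtain ⟨γ', rfl⟩ := hV.exists_eq_comp β' β (by omega)
  simp only [Quiver.Path.length_comp, Nat.cast_add] at h
  rw [hV.eq_of_length_eq γ' γ (by omega), hV.monomial_comp]

end NoBifurcations

end NoBifurcations

section LocalUnits

variable {K : Type*} [Field K] {V : Type u} [Quiver.{v} V] {a b : V}

open Filter in
theorem eventually_sum_vertex_mul (x : LeavittPathAlgebra K V) :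
    ∀ᶠ s : Finset V in atTop, (∑ b ∈ s, vertex K b) * x = x := by
  let p : Submodule K (LeavittPathAlgebra K V) :=
    { carrier := {x | ∀ᶠ s : Finset V in atTop, (∑ b ∈ s, vertex K b) * x = x}
      zero_mem' := .of_forall fun _ => mul_zero _
      add_mem' := fun hx hy => by
        filter_upwards [hx, hy] with s hx hy
        rw [mul_add, hx, hy]
      smul_mem' := fun k x hx => by
        filter_upwards [hx] with s hx
        rw [mul_smul_comm, hx] }
  suffices p = ⊤ from this.ge Submodule.mem_top
  refine eq_top_of_monomial_mem @fun a _ _ α β => ?_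
  filter_upwards [eventually_ge_atTop {a}] with s hs
  rw [← vertex_mul_monomial, ← mul_assoc, Finset.sum_mul,
    Finset.sum_eq_single_of_mem a (hs (Finset.mem_singleton_self a))
      fun b _ hb => vertex_mul_vertex_of_ne hb, vertex_mul_self]

theorem exists_vertex_mul_ne_zero {x : LeavittPathAlgebra K V} (hx : x ≠ 0) :
    ∃ b, vertex K b * x ≠ 0 := by
  by_contra! h
  obtain ⟨s, hs⟩ := (eventually_sum_vertex_mul x).exists
  exact hx (by rw [← hs, Finset.sum_mul, Finset.sum_eq_zero fun b _ => h b])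

theorem vertex_mul_mul_vertex_mem_span {n : ℤ} {x : LeavittPathAlgebra K V}
    (hx : x ∈ component K V n) (b a : V) :
    vertex K b * x * vertex K a ∈ Submodule.span K {y | ∃ (c : V) (α : Quiver.Path b c)
      (β : Quiver.Path a c), (α.length : ℤ) - β.length = n ∧ monomial K α β = y} := by
  set p := Submodule.span K {y | ∃ (c : V) (α : Quiver.Path b c)
      (β : Quiver.Path a c), (α.length : ℤ) - β.length = n ∧ monomial K α β = y}
  suffices component K V n ≤
      p.comap (LinearMap.mulRight K (vertex K a) ∘ₗ LinearMap.mulLeft K (vertex K b)) from this hx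
  refine component_le @fun b' a' c α β hn => ?_
  change vertex K b * monomial K α β * vertex K a ∈ p
  obtain rfl | hb := eq_or_ne b b'
  · obtain rfl | ha := eq_or_ne a' a
    · rw [vertex_mul_monomial, monomial_mul_vertex]
      exact Submodule.subset_span ⟨c, α, β, hn, rfl⟩
    · rw [← monomial_mul_vertex, mul_assoc, mul_assoc, vertex_mul_vertex_of_ne ha, mul_zero,
        mul_zero]
      exact zero_mem p
  · rw [← vertex_mul_monomial, ← mul_assoc, vertex_mul_vertex_of_ne hb, zero_mul, zero_mul]
    exact zero_mem p

variable (K) in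
/-- The left ideal `L_K(Q) a` generated by the vertex `a`. -/
noncomputable def vertexLeftIdeal (a : V) : Submodule K (LeavittPathAlgebra K V) :=
  LinearMap.eqLocus (LinearMap.mulRight K (vertex K a)) LinearMap.id

theorem mem_vertexLeftIdeal {x : LeavittPathAlgebra K V} :
    x ∈ vertexLeftIdeal K a ↔ x * vertex K a = x := Iff.rfl

theorem isLeftIdeal_vertexLeftIdeal : IsLeftIdeal (vertexLeftIdeal K a) := fun y x hx => by
  rw [mem_vertexLeftIdeal] at hx ⊢
  rw [mul_assoc, hx]

theorem vertex_mem_vertexLeftIdeal : vertex K a ∈ vertexLeftIdeal K a := vertex_mul_self a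

theorem mul_vertex_mem_vertexLeftIdeal (x : LeavittPathAlgebra K V) :
    x * vertex K a ∈ vertexLeftIdeal K a :=
  isLeftIdeal_vertexLeftIdeal x _ vertex_mem_vertexLeftIdeal

theorem isHomogeneous_vertexLeftIdeal :
    IsHomogeneous (component K V) (vertexLeftIdeal K a) := fun x hx => by
  have h_le : ⨆ n, component K V n ≤
      (⨆ n, vertexLeftIdeal K a ⊓ component K V n).comap (LinearMap.mulRight K (vertex K a)) := by
    refine iSup_le fun n y hy => Submodule.mem_iSup_of_mem n
      ⟨mul_vertex_mem_vertexLeftIdeal y, ?_⟩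
    have h_mem := SetLike.mul_mem_graded hy (vertex_mem_component (K := K) a)
    rwa [add_zero] at h_mem
  rw [← mem_vertexLeftIdeal.1 hx]
  exact h_le (iSup_component (K := K) (V := V) ▸ Submodule.mem_top)

theorem iSupIndep_vertexLeftIdeal : iSupIndep (vertexLeftIdeal K (V := V)) := fun a => by
  have h_le : ⨆ b, ⨆ _ : b ≠ a, vertexLeftIdeal K b ≤
      LinearMap.ker (LinearMap.mulRight K (vertex K a)) := iSup₂_le fun b hb x hx => by
    rw [LinearMap.mem_ker, LinearMap.mulRight_apply, ← mem_vertexLeftIdeal.1 hx, mul_assoc,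
      vertex_mul_vertex_of_ne hb, mul_zero]
  exact Submodule.disjoint_def.2 fun x hx hx' => (mem_vertexLeftIdeal.1 hx).symm.trans (h_le hx')

theorem iSup_vertexLeftIdeal : ⨆ a : V, vertexLeftIdeal K a = ⊤ :=
  eq_top_of_monomial_mem @fun _ b _ α β =>
    Submodule.mem_iSup_of_mem b (mem_vertexLeftIdeal.2 (monomial_mul_vertex α β))

theorem isGradedInvolution_involution : IsGradedInvolution (component K V) (involution K V) where
  involutive := involution_involution
  map_mul := involution_mul
  map_mem := involution_mem_component

namespace NoBifurcations

variable (hV : NoBifurcations V)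
include hV

theorem exists_eq_smul_monomial {n : ℤ} {x : LeavittPathAlgebra K V}
    (hx : x ∈ component K V n) (h : vertex K b * x * vertex K a ≠ 0) :
    ∃ (c : V) (α : Quiver.Path b c) (β : Quiver.Path a c) (k : K),
      vertex K b * x * vertex K a = k • monomial K α β := by
  have h_mem := vertex_mul_mul_vertex_mem_span hx b a
  set s := {y | ∃ (c : V) (α : Quiver.Path b c)
      (β : Quiver.Path a c), (α.length : ℤ) - β.length = n ∧ monomial K α β = y} with hs
  have h_sub : s.Subsingleton := by
    rintro _ ⟨c, α, β, hn, rfl⟩ _ ⟨c', α', β', hn', rfl⟩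
    exact hV.monomial_eq α β α' β' (hn.trans hn'.symm)
  obtain h_empty | ⟨y, hy⟩ := h_sub.eq_empty_or_singleton
  · rw [h_empty, Submodule.span_empty, Submodule.mem_bot] at h_mem
    exact absurd h_mem h
  · rw [hy, Submodule.mem_span_singleton] at h_mem
    obtain ⟨c, α, β, -, rfl⟩ : y ∈ s := hy ▸ Set.mem_singleton y
    exact ⟨c, α, β, h_mem.imp fun _ => Eq.symm⟩

theorem exists_mul_eq_vertex {n : ℤ} {x : LeavittPathAlgebra K V} (hx : x ∈ component K V n)
    (hx0 : x ≠ 0) (hxa : x * vertex K a = x) : ∃ y, y * x = vertex K a := by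
  obtain ⟨b, hb⟩ := exists_vertex_mul_ne_zero hx0
  have hbx : vertex K b * x * vertex K a = vertex K b * x := by rw [mul_assoc, hxa]
  obtain ⟨c, α, β, k, hk⟩ := hV.exists_eq_smul_monomial (a := a) hx (hbx.symm ▸ hb)
  rw [hbx] at hk
  have hk0 : k ≠ 0 := by
    rintro rfl
    exact hb (hk.trans (zero_smul K _))
  refine ⟨k⁻¹ • (monomial K β α * vertex K b), ?_⟩
  rw [smul_mul_assoc, mul_assoc, hk, mul_smul_comm, inv_smul_smul₀ hk0, hV.monomial_mul_monomial]

theorem isGradedSimpleLeft_vertexLeftIdeal (a : V) :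
    IsGradedSimpleLeft (component K V) (vertexLeftIdeal K a) where
  isLeftIdeal := isLeftIdeal_vertexLeftIdeal
  isHomogeneous := isHomogeneous_vertexLeftIdeal
  mul_ne_zero := ⟨vertex K a, vertex K a, vertex_mem_vertexLeftIdeal, by
    rw [vertex_mul_self]
    exact vertex_ne_zero K a⟩
  eq_bot_or_eq J hJ hJ_left hJ_hom := by
    refine or_iff_not_imp_left.2 fun h_bot => hJ.antisymm fun z hz => ?_
    obtain ⟨n, x, hxJ, hxn, hx0⟩ := hJ_hom.exists_mem_ne_zero h_bot
    obtain ⟨y, hy⟩ := hV.exists_mul_eq_vertex hxn hx0 (hJ hxJ)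
    have ha : vertex K a ∈ J := hy ▸ hJ_left y x hxJ
    rw [← mem_vertexLeftIdeal.1 hz]
    exact hJ_left z _ ha

theorem isGradedSemisimple : IsGradedSemisimple (component K V) :=
  isGradedInvolution_involution.isGradedSemisimple hV.isGradedSimpleLeft_vertexLeftIdeal
    iSupIndep_vertexLeftIdeal iSup_vertexLeftIdeal

end NoBifurcations

end LocalUnits

section Diagonal

variable {K : Type*} [Field K] {V : Type u} [Quiver.{v} V]

/-- The arrow `e` of `[e, f]`. -/
def KroneckerSquare.fstArrow (g : Quiver.Total (KroneckerSquare V)) : Quiver.Total V :=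
  ⟨g.left.fst, g.right.fst, g.hom.1⟩

/-- The arrow `f` of `[e, f]`. -/
def KroneckerSquare.sndArrow (g : Quiver.Total (KroneckerSquare V)) : Quiver.Total V :=
  ⟨g.left.snd, g.right.snd, g.hom.2⟩

open KroneckerSquare

theorem KroneckerSquare.pairArrow_fstArrow_sndArrow (g : Quiver.Total (KroneckerSquare V)) :
    pairArrow (fstArrow g) (sndArrow g) = g := rfl

theorem KroneckerSquare.arrow_ext {g h : Quiver.Total (KroneckerSquare V)}
    (h_fst : fstArrow g = fstArrow h) (h_snd : sndArrow g = sndArrow h) : g = h := by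
  rw [← pairArrow_fstArrow_sndArrow g, h_fst, h_snd, pairArrow_fstArrow_sndArrow]

theorem NoBifurcations.kroneckerSquare (hV : NoBifurcations V) :
    NoBifurcations (KroneckerSquare V) := by
  rintro a ⟨g, hg, h, hh, hgh⟩
  have h_left : g.left = h.left := hg.trans hh.symm
  exact hgh (arrow_ext (hV.eq_of_left_eq (congrArg fst h_left))
    (hV.eq_of_left_eq (congrArg snd h_left)))

theorem vertex_mem_diagonalSubalgebra (a : V) :
    vertex K (⟨a, a⟩ : KroneckerSquare V) ∈ diagonalSubalgebra K V :=
  NonUnitalAlgebra.subset_adjoin K (.inl (.inl ⟨a, rfl⟩))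

theorem involution_mem_diagonalSubalgebra {x : LeavittPathAlgebra K (KroneckerSquare V)}
    (hx : x ∈ diagonalSubalgebra K V) :
    involution K (KroneckerSquare V) x ∈ diagonalSubalgebra K V := by
  induction hx using NonUnitalAlgebra.adjoin_induction with
  | mem x hx =>
    refine NonUnitalAlgebra.subset_adjoin K ?_
    obtain (⟨a, rfl⟩ | ⟨e, rfl⟩) | ⟨e, rfl⟩ := hx
    · exact .inl (.inl ⟨a, (involution_vertex _).symm⟩)
    · exact .inr ⟨e, (involution_arrow _).symm⟩
    · exact .inl (.inr ⟨e, (involution_ghost _).symm⟩)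
  | zero => rw [map_zero]; exact zero_mem _
  | add x y _ _ hx hy => rw [map_add]; exact add_mem hx hy
  | mul x y _ _ hx hy => rw [involution_mul]; exact mul_mem hy hx
  | smul k x _ hx => rw [map_smul]; exact SMulMemClass.smul_mem k hx

theorem isLeftIdeal_diagonalSubalgebra_iff :
    IsLeftIdeal (diagonalSubalgebra K V).toSubmodule ↔
      IsRightIdeal (diagonalSubalgebra K V).toSubmodule := by
  constructor
  · intro h a x hx
    rw [← involution_involution (x * a), involution_mul]
    exact involution_mem_diagonalSubalgebra (h _ _ (involution_mem_diagonalSubalgebra hx))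
  · intro h a x hx
    rw [← involution_involution (a * x), involution_mul]
    exact involution_mem_diagonalSubalgebra (h _ _ (involution_mem_diagonalSubalgebra hx))

theorem eq_of_arrow_mem_diagonalSubalgebra {e f : Quiver.Total V}
    (h : arrow K (pairArrow e f) ∈ diagonalSubalgebra K V) : e = f := by
  have h_le : diagonalSubalgebra K V ≤ NonUnitalAlgebra.adjoin K (Set.range (vertex K) ∪
      arrow K '' Set.range (fun e : Quiver.Total V => pairArrow e e) ∪
      ghost K '' Set.range fun e : Quiver.Total V => pairArrow e e) := by
    rw [← Set.range_comp, ← Set.range_comp]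
    exact NonUnitalAlgebra.adjoin_mono <| Set.union_subset_union_left _ <|
      Set.union_subset_union_left _ (Set.range_comp_subset_range _ (vertex K))
  obtain ⟨g, hg⟩ := mem_of_arrow_mem_adjoin (h_le h)
  exact (congrArg fstArrow hg).symm.trans (congrArg sndArrow hg)

theorem noBifurcations_of_isRightIdeal
    (hS : IsRightIdeal (diagonalSubalgebra K V).toSubmodule) : NoBifurcations V := by
  rintro _ ⟨e, rfl, f, hf, hef⟩
  refine hef (eq_of_arrow_mem_diagonalSubalgebra (K := K) ?_)
  have h_left : (pairArrow e f).left = ⟨e.left, e.left⟩ := KroneckerSquare.ext rfl hf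
  have h_vertex : vertex K (pairArrow e f).left ∈ diagonalSubalgebra K V :=
    h_left ▸ vertex_mem_diagonalSubalgebra e.left
  exact left_mul_arrow (K := K) (pairArrow e f) ▸ hS _ _ h_vertex

theorem right_injective_of_isLeftIdeal
    (hS : IsLeftIdeal (diagonalSubalgebra K V).toSubmodule) :
    Function.Injective (Quiver.Total.right : Quiver.Total V → V) := by
  refine fun e f hef => eq_of_arrow_mem_diagonalSubalgebra (K := K) ?_
  have h_right : (pairArrow e f).right = ⟨f.right, f.right⟩ := KroneckerSquare.ext hef rfl
  have h_vertex : vertex K (pairArrow e f).right ∈ diagonalSubalgebra K V :=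
    h_right ▸ vertex_mem_diagonalSubalgebra f.right
  exact arrow_mul_right (K := K) (pairArrow e f) ▸ hS _ _ h_vertex

theorem NoBifurcations.isLeavittFamily_diagonal (hV : NoBifurcations V) :
    IsLeavittFamily (fun a : V => vertex K (⟨a, a⟩ : KroneckerSquare V))
      (fun e => arrow K (pairArrow e e)) (fun e => ghost K (pairArrow e e)) where
  vertex_mul_self _ := vertex_mul_self _
  vertex_mul_vertex _ _ hab := vertex_mul_vertex_of_ne fun h => hab (congrArg fst h)
  left_mul_arrow e := left_mul_arrow (pairArrow e e)
  arrow_mul_right e := arrow_mul_right (pairArrow e e)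
  right_mul_ghost e := right_mul_ghost (pairArrow e e)
  ghost_mul_left e := ghost_mul_left (pairArrow e e)
  ghost_mul_arrow_self e := ghost_mul_arrow_self (pairArrow e e)
  ghost_mul_arrow _ _ hef := ghost_mul_arrow_of_ne fun h => hef (congrArg fstArrow h)
  vertex_eq_sum := by
    rintro _ ⟨⟨e, rfl⟩, h_fin⟩
    rw [hV.sum_emitted]
    exact (hV.kroneckerSquare.arrow_mul_ghost (pairArrow e e)).symm

open scoped Classical in
theorem NoBifurcations.isLeavittFamily_diagonalPart (hV : NoBifurcations V)
    (h_right : Function.Injective (Quiver.Total.right : Quiver.Total V → V)) :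
    IsLeavittFamily (fun x : KroneckerSquare V => if x.fst = x.snd then vertex K x.fst else 0)
      (fun g => if fstArrow g = sndArrow g then arrow K (fstArrow g) else 0)
      (fun g => if fstArrow g = sndArrow g then ghost K (fstArrow g) else 0) := by
  have h_left_iff (g : Quiver.Total (KroneckerSquare V)) :
      g.left.fst = g.left.snd ↔ fstArrow g = sndArrow g :=
    ⟨fun h => hV.eq_of_left_eq h, congrArg Quiver.Total.left⟩
  have h_right_iff (g : Quiver.Total (KroneckerSquare V)) :
      g.right.fst = g.right.snd ↔ fstArrow g = sndArrow g :=
    ⟨fun h => h_right h, congrArg Quiver.Total.right⟩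
  refine
    { vertex_mul_self := fun a => ?_
      vertex_mul_vertex := fun a b hab => ?_
      left_mul_arrow := fun g => ?_
      arrow_mul_right := fun g => ?_
      right_mul_ghost := fun g => ?_
      ghost_mul_left := fun g => ?_
      ghost_mul_arrow_self := fun g => ?_
      ghost_mul_arrow := fun g h hgh => ?_
      vertex_eq_sum := ?_ }
  · split_ifs <;> simp only [vertex_mul_self, mul_zero]
  · split_ifs with ha hb
    · exact vertex_mul_vertex_of_ne fun h => hab (KroneckerSquare.ext h (by rw [← ha, h, hb]))
    all_goals simp only [mul_zero, zero_mul]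
  · simp only [h_left_iff]
    split_ifs
    exacts [left_mul_arrow (fstArrow g), mul_zero 0]
  · simp only [h_right_iff]
    split_ifs
    exacts [arrow_mul_right (fstArrow g), mul_zero 0]
  · simp only [h_right_iff]
    split_ifs
    exacts [right_mul_ghost (fstArrow g), mul_zero 0]
  · simp only [h_left_iff]
    split_ifs
    exacts [ghost_mul_left (fstArrow g), mul_zero 0]
  · simp only [h_right_iff]
    split_ifs
    exacts [ghost_mul_arrow_self (fstArrow g), mul_zero 0]
  · split_ifs with hg hh
    · exact ghost_mul_arrow_of_ne fun h_fst => hgh (arrow_ext h_fst (by rw [← hg, h_fst, hh]))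
    all_goals simp only [mul_zero, zero_mul]
  · rintro _ ⟨⟨g, rfl⟩, h_fin⟩
    rw [hV.kroneckerSquare.sum_emitted]
    simp only [h_left_iff]
    split_ifs
    exacts [(hV.arrow_mul_ghost (fstArrow g)).symm, (mul_zero 0).symm]

/-- The homomorphism `L_K(Q̂) → L_K(Q)` that sends `[a, a]`, `[e, e]`, `[e, e]*` to `a`, `e`, `e*`
and the other generators to `0`. -/
noncomputable def NoBifurcations.diagonalPart (hV : NoBifurcations V)
    (h_right : Function.Injective (Quiver.Total.right : Quiver.Total V → V)) :
    LeavittPathAlgebra K (KroneckerSquare V) →ₙₐ[K] LeavittPathAlgebra K V :=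
  (hV.isLeavittFamily_diagonalPart h_right).lift K

theorem NoBifurcations.diagonalPart_mem_component (hV : NoBifurcations V)
    (h_right : Function.Injective (Quiver.Total.right : Quiver.Total V → V)) {n : ℤ}
    {x : LeavittPathAlgebra K (KroneckerSquare V)}
    (hx : x ∈ component K (KroneckerSquare V) n) :
    hV.diagonalPart h_right x ∈ component K V n := by
  refine map_mem_of_mem_component (fun a => ?_) (fun g => ?_) (fun g => ?_) hx
  · rw [diagonalPart, IsLeavittFamily.lift_vertex]
    split_ifs
    exacts [vertex_mem_component _, zero_mem _]
  · rw [diagonalPart, IsLeavittFamily.lift_arrow]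
    split_ifs
    exacts [arrow_mem_component _, zero_mem _]
  · rw [diagonalPart, IsLeavittFamily.lift_ghost]
    split_ifs
    exacts [ghost_mem_component _, zero_mem _]

theorem NoBifurcations.exists_isDiagonal (hV : NoBifurcations V) :
    ∃ φ : LeavittPathAlgebra K V →ₙₐ[K] LeavittPathAlgebra K (KroneckerSquare V),
      IsDiagonal K φ :=
  have h := hV.isLeavittFamily_diagonal (K := K)
  ⟨h.lift K, h.lift_vertex, h.lift_arrow, h.lift_ghost⟩

namespace IsDiagonal

variable {φ : LeavittPathAlgebra K V →ₙₐ[K] LeavittPathAlgebra K (KroneckerSquare V)}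
  (hφ : IsDiagonal K φ)
include hφ

theorem range_eq : NonUnitalAlgHom.range φ = diagonalSubalgebra K V := by
  rw [← NonUnitalAlgebra.map_top, ← adjoin_generators, NonUnitalAlgHom.map_adjoin, generators,
    Set.image_union, Set.image_union, ← Set.range_comp, ← Set.range_comp, ← Set.range_comp]
  simp only [Function.comp_def, hφ.1, hφ.2.1, hφ.2.2]
  rfl

theorem exact_mkQ : Function.Exact φ (diagonalSubalgebra K V).toSubmodule.mkQ := fun y => by
  rw [← LinearMap.mem_ker, Submodule.ker_mkQ, ← hφ.range_eq]
  rfl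

theorem map_mem_component {n : ℤ} {x : LeavittPathAlgebra K V} (hx : x ∈ component K V n) :
    φ x ∈ component K (KroneckerSquare V) n :=
  map_mem_of_mem_component (fun a => hφ.1 a ▸ vertex_mem_component _)
    (fun e => hφ.2.1 e ▸ arrow_mem_component _) (fun e => hφ.2.2 e ▸ ghost_mem_component _) hx

variable (hV : NoBifurcations V)
  (h_right : Function.Injective (Quiver.Total.right : Quiver.Total V → V))

theorem diagonalPart_leftInverse : Function.LeftInverse (hV.diagonalPart h_right) φ := by
  have h_comp : (hV.diagonalPart h_right).comp φ = NonUnitalAlgHom.id K _ := by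
    apply algHom_ext <;> intro <;>
      simp [hφ.1, hφ.2.1, hφ.2.2, NoBifurcations.diagonalPart, pairArrow, fstArrow, sndArrow]
  exact DFunLike.congr_fun h_comp

include hV h_right in
theorem map_mem_component_iff {n : ℤ} {x : LeavittPathAlgebra K V} :
    φ x ∈ component K (KroneckerSquare V) n ↔ x ∈ component K V n := by
  refine ⟨fun hx => ?_, hφ.map_mem_component⟩
  rw [← hφ.diagonalPart_leftInverse hV h_right x]
  exact hV.diagonalPart_mem_component h_right hx

theorem isGradedRetraction :
    IsGradedRetraction (component K (KroneckerSquare V)) (diagonalSubalgebra K V).toSubmodule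
      (φ.comp (hV.diagonalPart h_right)) where
  map_mem x := hφ.range_eq ▸ ⟨_, rfl⟩
  map_eq_self {x} hx := by
    obtain ⟨y, rfl⟩ : x ∈ NonUnitalAlgHom.range φ := hφ.range_eq ▸ hx
    exact congrArg φ (hφ.diagonalPart_leftInverse hV h_right y)
  map_mem_component hx := hφ.map_mem_component (hV.diagonalPart_mem_component h_right hx)

end IsDiagonal

end Diagonal

end Leavitt

theorem mainTheorem7_general (K : Type*) [Field K] (V : Type u) [Quiver.{v} V]
    (hS : Leavitt.IsLeftIdeal (Leavitt.diagonalSubalgebra K V).toSubmodule ∨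
      Leavitt.IsRightIdeal (Leavitt.diagonalSubalgebra K V).toSubmodule) :
    (∀ a : V, Leavitt.IsSink a ∨ Leavitt.IsRayPoint a ∨ Leavitt.IsLaurentVertex a) ∧
    Leavitt.IsGradedSemisimple (Leavitt.component K (Leavitt.KroneckerSquare V)) ∧
    (∃ φ : Leavitt.LeavittPathAlgebra K V →ₙₐ[K]
        Leavitt.LeavittPathAlgebra K (Leavitt.KroneckerSquare V),
      Leavitt.IsDiagonal K φ ∧
      (∀ (n : ℤ) (x : Leavitt.LeavittPathAlgebra K V),
        φ x ∈ Leavitt.component K (Leavitt.KroneckerSquare V) n ↔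
          x ∈ Leavitt.component K V n) ∧
      Function.Injective φ ∧
      Function.Exact φ (Leavitt.diagonalSubalgebra K V).toSubmodule.mkQ ∧
      Function.Surjective (Leavitt.diagonalSubalgebra K V).toSubmodule.mkQ ∧
      Leavitt.IsHomogeneous (Leavitt.component K (Leavitt.KroneckerSquare V))
        (Leavitt.diagonalSubalgebra K V).toSubmodule ∧
      Leavitt.SplitsLeft (Leavitt.component K (Leavitt.KroneckerSquare V))
        (Leavitt.diagonalSubalgebra K V).toSubmodule ∧
      Leavitt.SplitsRight (Leavitt.component K (Leavitt.KroneckerSquare V))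
        (Leavitt.diagonalSubalgebra K V).toSubmodule) := by
  have hleft := hS.elim id Leavitt.isLeftIdeal_diagonalSubalgebra_iff.2
  have hright := Leavitt.isLeftIdeal_diagonalSubalgebra_iff.1 hleft
  have hV := Leavitt.noBifurcations_of_isRightIdeal hright
  have h_inj := Leavitt.right_injective_of_isLeftIdeal hleft
  obtain ⟨φ, hφ⟩ := hV.exists_isDiagonal (K := K)
  have hπ := hφ.isGradedRetraction hV h_inj
  exact ⟨fun a => .inr (hV.isRayPoint_or_isLaurentVertex a),
    hV.kroneckerSquare.isGradedSemisimple, φ, hφ,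
    fun _ _ => hφ.map_mem_component_iff hV h_inj,
    (hφ.diagonalPart_leftInverse hV h_inj).injective, hφ.exact_mkQ, Submodule.mkQ_surjective _,
    hπ.isHomogeneous Leavitt.iSup_component, hπ.splitsLeft hleft, hπ.splitsRight hright⟩

theorem mainTheorem7 (K : Type*) [Field K] (V : Type u) [Quiver.{v} V]
    (hleft : Leavitt.IsLeftIdeal (Leavitt.diagonalSubalgebra K V).toSubmodule)
    (hright : Leavitt.IsRightIdeal (Leavitt.diagonalSubalgebra K V).toSubmodule) :
    (∀ a : V, Leavitt.IsSink a ∨ Leavitt.IsRayPoint a ∨ Leavitt.IsLaurentVertex a) ∧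
    Leavitt.IsGradedSemisimple (Leavitt.component K (Leavitt.KroneckerSquare V)) ∧
    (∃ φ : Leavitt.LeavittPathAlgebra K V →ₙₐ[K]
        Leavitt.LeavittPathAlgebra K (Leavitt.KroneckerSquare V),
      Leavitt.IsDiagonal K φ ∧
      (∀ (n : ℤ) (x : Leavitt.LeavittPathAlgebra K V),
        φ x ∈ Leavitt.component K (Leavitt.KroneckerSquare V) n ↔
          x ∈ Leavitt.component K V n) ∧
      Function.Injective φ ∧
      Function.Exact φ (Leavitt.diagonalSubalgebra K V).toSubmodule.mkQ ∧
      Function.Surjective (Leavitt.diagonalSubalgebra K V).toSubmodule.mkQ ∧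
      Leavitt.IsHomogeneous (Leavitt.component K (Leavitt.KroneckerSquare V))
        (Leavitt.diagonalSubalgebra K V).toSubmodule ∧
      Leavitt.SplitsLeft (Leavitt.component K (Leavitt.KroneckerSquare V))
        (Leavitt.diagonalSubalgebra K V).toSubmodule ∧
      Leavitt.SplitsRight (Leavitt.component K (Leavitt.KroneckerSquare V))
        (Leavitt.diagonalSubalgebra K V).toSubmodule) :=
  mainTheorem7_general K V (.inl hleft)
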